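/- Let $\mathbb R^*=\mathbb R\setminus\{0\}$. For each sign $s\in\{+,-\}$ let $(\xi^{s,k})_{k\ge0}$ be i.i.d. copies of a real L\'evy process $\xi^{s}=\xi^{s,0}$ started at $0$, $(\zeta^{s,k})_{k\ge0}$ i.i.d. exponential random variables of parameter $q^{s}\in[0,\infty)$ (with $\zeta^{s,k}=\infty$ a.s. if $q^{s}=0$), and $(U^{s,k})_{k\ge0}$ i.i.d. copies of a real random variable $U^{s}=U^{s,0}$, all of these objects being independent. For $x\in\mathbb R^*$ let $(\xi^{(x,k)},\zeta^{(x,k)},U^{(x,k)})$ be $(\xi^{s,k},\zeta^{s,k},U^{s,k})$ with $s$ the sign of $\mathrm{sgn}(x)(-1)^k$, put $T_n^{(x)}=\sum_{k=0}^{n-1}\zeta^{(x,k)}$, $N_t^{(x)}=\max\{n\ge0: T^{(x)}_n\le t\}$, and let the Lamperti--Kiu process started at $x$ be $$Y^{(x)}_t=x\exp\Big\{\xi^{(x,N)}_{t-T^{(x)}_{N}}+\sum_{k=0}^{N-1}\big(\xi^{(x,k)}_{\zeta^{(x,k)}}+U^{(x,k)}\big)+i\pi N\Big\},\qquad N=N_t^{(x)}.$$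 The infinitesimal generator of a family of processes $(X^{(x)})_{x\in E}$ on $E$, where $X^{(x)}$ starts at $x$, is the operator $f\mapsto\lim_{t\downarrow0}t^{-1}(\mathbf E[f(X^{(\cdot)}_t)]-f)$ on $C_0(E)$, whose domain is the set of $f\in C_0(E)$ for which the limit exists in the supremum norm and is in $C_0(E)$. Let $\mathcal K$ be the generator of $(Y^{(x)})_{x\in\mathbb R^*}$ on $C_0(\mathbb R^*)$ and $\mathcal A^{\pm}$ the generator of $\xi^{\pm}$ (that is, of $(y+\xi^\pm)_{y\in\mathbb R}$) on $C_0(\mathbb R)$, with domain $\mathcal D_{\mathcal A^\pm}$. Let $f:\mathbb R\to\mathbb R$ be bounded and continuous with $f(0)=0$, $f\circ\exp\in\mathcal D_{\mathcal A^+}$ and $f\circ(-\exp)\in\mathcal D_{\mathcal A^-}$. Then $f|_{\mathbb R^*}$ is in the domain of $\mathcal K$, and for every $x\in\mathbb R^*$ $$\mathcal Kf(x)=\mathcal A^{\mathrm{sgn}(x)}\big(f\circ\mathrm{sgn}(x)\exp\big)(\log|x|)+q^{\mathrm{sgn}(x)}\,\mathbf E\big[f(-xe^{U^{\mathrm{sgn}(x)}})-f(x)\big].$$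 Moreover, let $l:\mathbb R\to\mathbb R$ be bounded and measurable with $l(y)=y+O(y^2)$ as $y\to0$, and suppose that $\xi^\pm$ has characteristics $(a^\pm,\sigma^\pm,\pi^\pm)$ relative to $l$: $a^\pm,\sigma^\pm\in\mathbb R$, $\pi^\pm$ is a measure on $\mathbb R$ with $\pi^\pm(\{0\})=0$ and $\int(1\wedge y^2)\,\pi^\pm(dy)<\infty$, and $\mathbf E[e^{i\lambda\xi^\pm_t}]=e^{t\psi^\pm(\lambda)}$ for all $t\ge0$ and $\lambda\in\mathbb R$, where $$\psi^\pm(\lambda)=ia^\pm\lambda-\tfrac{(\sigma^{\pm})^2}{2}\lambda^2+\int_{\mathbb R}\big[e^{i\lambda y}-1-i\lambda l(y)\big]\pi^\pm(dy).$$ If in addition $f$ is twice continuously differentiable on $\mathbb R^*$, then for every $x\in\mathbb R^*$, with $s=\mathrm{sgn}(x)$, $b^{s}=a^{s}+(\sigma^{s})^2/2$ and $\Theta^{s}$ the image of $\pi^{s}$ under $\exp$, $$\mathcal Kf(x)=b^{s}xf'(x)+\tfrac{(\sigma^{s})^2}{2}x^2f''(x)+\int_{(0,\infty)}\big[f(xu)-f(x)-xf'(x)l(\log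 u)\big]\Theta^{s}(du)+q^{s}\,\mathbf E\big[f(-xe^{U^{s}})-f(x)\big],$$ where the integral converges absolutely. -/

import Mathlib

open MeasureTheory ProbabilityTheory Filter Topology
open scoped NNReal ENNReal

noncomputable section

namespace LampertiKiu

/-! ### Infinitesimal generators on `C₀(E)` -/

section Generator

variable {Ω : Type*} [MeasurableSpace Ω] {E : Type*} [TopologicalSpace E]

/-- The function `f` belongs to `C₀(E)`: it is continuous and vanishes at infinity. -/
def IsC0 (f : E → ℝ) : Prop :=
  Continuous f ∧ Tendsto f (cocompact E) (𝓝 0)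

/-- Let `X x t` be the position at time `t` of a process started at `x`, so that
`Q_t f (x) = E[f (X x t)]`. The relation says that `f` and `g` are in `C₀(E)` and that
`(Q_t f - f) / t` converges to `g` in the supremum norm as `t ↓ 0`. -/
def HasGenerator (P : Measure Ω) (X : E → ℝ≥0 → Ω → E) (f g : E → ℝ) : Prop :=
  IsC0 f ∧ IsC0 g ∧
    TendstoUniformly
      (fun (t : ℝ≥0) (x : E) => (t : ℝ)⁻¹ * ((∫ ω, f (X x t ω) ∂P) - f x)) g (𝓝[>] 0)

/-- The value of the generator at `f` is unique. -/
theorem HasGenerator.unique {P : Measure Ω} {X : E → ℝ≥0 → Ω → E} {f g h : E → ℝ}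
    (hg : HasGenerator P X f g) (hh : HasGenerator P X f h) : g = h :=
  funext fun x => tendsto_nhds_unique (hg.2.2.tendsto_at x) (hh.2.2.tendsto_at x)

/-- The domain of the infinitesimal generator of the family `X`. -/
def generatorDomain (P : Measure Ω) (X : E → ℝ≥0 → Ω → E) : Set (E → ℝ) :=
  {f | ∃ g, HasGenerator P X f g}

open scoped Classical in
/-- The infinitesimal generator of the family `X` (equal to `0` outside of its domain). -/
def generator (P : Measure Ω) (X : E → ℝ≥0 → Ω → E) (f : E → ℝ) : E → ℝ :=
  if h : ∃ g, HasGenerator P X f g then h.choose else 0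

/-- On its domain, the operator `generator` is given by the limit. -/
theorem HasGenerator.generator_eq {P : Measure Ω} {X : E → ℝ≥0 → Ω → E} {f g : E → ℝ}
    (hg : HasGenerator P X f g) : generator P X f = g := by
  have h : ∃ g, HasGenerator P X f g := ⟨g, hg⟩
  rw [generator, dif_pos h]
  exact h.choose_spec.unique hg

end Generator

/-! ### Lévy processes -/

/-- A real function on `[0, ∞)` that is right-continuous and has finite left limits. -/
def IsCadlag (w : ℝ≥0 → ℝ) : Prop :=
  ∀ t, ContinuousWithinAt w (Set.Ici t) t ∧ ∃ y, Tendsto w (𝓝[<] t) (𝓝 y)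

/-- Real-valued Lévy processes started at `0`. -/
structure IsLevyProcess {Ω : Type*} [MeasurableSpace Ω] (P : Measure Ω)
    (ξ : ℝ≥0 → Ω → ℝ) : Prop where
  measurable : ∀ t, Measurable (ξ t)
  zero : ∀ᵐ ω ∂P, ξ 0 ω = 0
  indep : HasIndepIncrements ξ P
  stationary : ∀ s t, IdentDistrib (fun ω => ξ (s + t) ω - ξ s ω) (ξ t) P P
  cadlag : ∀ᵐ ω ∂P, IsCadlag (fun t => ξ t ω)

/-- The process `y + ξ`, which is `ξ` started at `y`. -/
def translates {Ω : Type*} (ξ : ℝ≥0 → Ω → ℝ) (y : ℝ) (t : ℝ≥0) (ω : Ω) : ℝ :=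
  y + ξ t ω

/-- `π` is a Lévy measure: it does not charge `0` and integrates `1 ∧ y ^ 2`. -/
def IsLevyMeasure (π : Measure ℝ) : Prop :=
  π {0} = 0 ∧ ∫⁻ y, ENNReal.ofReal (min 1 (y ^ 2)) ∂π < ∞

/-- The characteristic exponent with drift `a`, Gaussian coefficient `σ` and Lévy measure `π`,
relative to the truncation function `l`. -/
def levyExponent (l : ℝ → ℝ) (a σ : ℝ) (π : Measure ℝ) (v : ℝ) : ℂ :=
  Complex.I * a * v - (σ : ℂ) ^ 2 / 2 * (v : ℂ) ^ 2 +
    ∫ y : ℝ, (Complex.exp (Complex.I * v * y) - 1 - Complex.I * v * l y) ∂π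

/-- `ξ` has characteristics `(a, σ, π)` relative to `l`: `E[exp (i v ξ_t)] = exp (t ψ (v))`. -/
def HasCharacteristics {Ω : Type*} [MeasurableSpace Ω] (P : Measure Ω) (ξ : ℝ≥0 → Ω → ℝ)
    (l : ℝ → ℝ) (a σ : ℝ) (π : Measure ℝ) : Prop :=
  ∀ (t : ℝ≥0) (v : ℝ), charFun (P.map (ξ t)) v = Complex.exp ((t : ℝ) * levyExponent l a σ π v)

/-! ### The Lamperti–Kiu process -/

/-- The state space `ℝ \ {0}`. -/
abbrev Rstar : Type := {x : ℝ // x ≠ 0}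

/-- The sign of a nonzero real number, as an element of `{1, -1}`. -/
def sgn (x : Rstar) : ℤˣ :=
  if 0 < (x : ℝ) then 1 else -1

/-- The random objects from which the process is built. The index `s : ℤˣ` is the sign `±`.
The holding times may be infinite, which is the case of rate `q s = 0`. -/
structure Data {Ω : Type*} [MeasurableSpace Ω] (P : Measure Ω) where
  /-- the rates of the holding times -/
  q : ℤˣ → ℝ≥0
  /-- the Lévy processes -/
  ξ : ℤˣ → ℕ → ℝ≥0 → Ω → ℝ
  /-- the holding times -/
  ζ : ℤˣ → ℕ → Ω → ℝ≥0∞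
  /-- the logarithmic jump factors at changes of sign -/
  U : ℤˣ → ℕ → Ω → ℝ
  levy : ∀ s k, IsLevyProcess P (ξ s k)
  identDistrib_ξ : ∀ s k,
    IdentDistrib (fun ω t => ξ s k t ω) (fun ω t => ξ s 0 t ω) P P
  measurable_ζ : ∀ s k, Measurable (ζ s k)
  exponential : ∀ s k (t : ℝ≥0),
    P {ω | (t : ℝ≥0∞) < ζ s k ω} = ENNReal.ofReal (Real.exp (-(q s * t)))
  measurable_U : ∀ s k, Measurable (U s k)
  identDistrib_U : ∀ s k, IdentDistrib (U s k) (U s 0) P P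
  /-- the triples `(ξ, ζ, U)` for different indices are independent, and so are, with the two
  fields below, the three components of each of them: all the objects are independent -/
  indep : iIndepFun
    (fun (i : ℤˣ × ℕ) ω => ((fun t => ξ i.1 i.2 t ω), (ζ i.1 i.2 ω, U i.1 i.2 ω))) P
  indep_ξ : ∀ s k, IndepFun (fun ω t => ξ s k t ω) (fun ω => (ζ s k ω, U s k ω)) P
  indep_ζ : ∀ s k, IndepFun (ζ s k) (U s k) P

namespace Data

variable {Ω : Type*} [MeasurableSpace Ω] {P : Measure Ω} (D : Data P)

/-- The sign in force after `k` changes of sign, for the starting point `x`. -/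
def sign (x : Rstar) (k : ℕ) : ℤˣ := sgn x * (-1) ^ k

/-- The time `T_n` of the `n`-th change of sign. -/
def T (x : Rstar) (n : ℕ) (ω : Ω) : ℝ≥0∞ :=
  ∑ k ∈ Finset.range n, D.ζ (sign x k) k ω

/-- The number `N_t = max {n | T_n ≤ t}` of changes of sign up to time `t`. -/
def N (x : Rstar) (t : ℝ≥0) (ω : Ω) : ℕ :=
  sSup {n | D.T x n ω ≤ t}

/-- The time `t - T_{N_t}` elapsed since the last change of sign. -/
def age (x : Rstar) (t : ℝ≥0) (ω : Ω) : ℝ≥0 :=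
  t - (D.T x (D.N x t ω) ω).toNNReal

/-- The real part of the exponent: the current Lévy process at the current age, plus the sum of
the earlier Lévy processes at the ends of their holding times and of the jump factors. -/
def expo (x : Rstar) (t : ℝ≥0) (ω : Ω) : ℝ :=
  D.ξ (sign x (D.N x t ω)) (D.N x t ω) (D.age x t ω) ω +
    ∑ k ∈ Finset.range (D.N x t ω),
      (D.ξ (sign x k) k (D.ζ (sign x k) k ω).toNNReal ω + D.U (sign x k) k ω)

/-- The Lamperti–Kiu process started at `x`. The imaginary part `i π N_t` of the exponent
contributes the factor `(-1) ^ N_t`. -/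
def Y (x : Rstar) (t : ℝ≥0) (ω : Ω) : Rstar :=
  ⟨x * (Real.exp (D.expo x t ω) * (-1) ^ D.N x t ω),
    mul_ne_zero x.2 (mul_ne_zero (Real.exp_ne_zero _) (pow_ne_zero _ (by norm_num)))⟩

end Data

end LampertiKiu

end

/-!
The generator of the Lamperti–Kiu process is found by conditioning on the first change of sign.
Started at `x` of sign `s`, the process equals `x exp ξ^s` before the holding time `ζ`, which is
independent of `ξ^s` and exceeds `t` with probability `exp (-q t)`; this part contributes
`𝒜^s (f ∘ s exp) (log |x|) - q f x`. With probability `1 - exp (-q t) ≈ q t` a change of sign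
occurs before `t`. Outside an event whose conditional probability tends to `0` it is the only one,
and both Lévy processes involved have moved by at most `δ`, so that `Y_t` is close to
`-x exp U`; since `f ∘ (± exp)` is uniformly continuous, this part contributes `q E[f (-x exp U)]`
uniformly in `x` (`Data.integral_comp_Y`, `Data.abs_setIntegral_sub_le`, `Data.hasGenerator_Y`).

For the explicit form, `h = f ∘ (s exp)` is a bounded function of class `C²` in the domain of the
generator of `ξ^s`, but nothing is known about the decay of its derivatives, so the value of the
generator is identified by weak convergence. Let `weight z = 1 - sin z / z`. Because it is an
average of `1 - exp (i u z)` over `u ∈ [-1, 1]`, the characteristic function of the measure with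
density `weight / t` with respect to the law of `ξ_t` is an average of increments of
`exp (t ψ) / t`. It converges as `t ↓ 0`, and Lévy's theorem yields the weak convergence of these
measures to `(σ² / 6) δ₀ + weight · π` (`tendsto_integral_weighted`). On the other hand
`h (y + z) - h y - h' (y) sin z` is `weight z` times a bounded continuous function of `z` with
value `3 h'' (y)` at `0`, and `E[sin ξ_t] / t` converges to the imaginary part of `ψ 1`. Together
these limits give the integro-differential operator (`tendsto_integral_sub_div`), with `sin` as
truncation function, then with `l`. The change of variables `x = s exp y` finishes the proof
(`integroDifferential_comp_mul_exp`).
-/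

/-! ### Weak convergence and a weight for Lévy measures -/

namespace LampertiKiu

/-- Pointwise convergence of characteristic functions of finite measures on `ℝ` implies weak
convergence. Adding a unit mass at `0` reduces this to probability measures, and covers the case
where the limit is the zero measure. -/
theorem tendsto_integral_of_tendsto_charFun {μ : ℕ → Measure ℝ} {ν : Measure ℝ}
    [∀ n, IsFiniteMeasure (μ n)] [IsFiniteMeasure ν]
    (h : ∀ v, Tendsto (fun n => charFun (μ n) v) atTop (𝓝 (charFun ν v)))
    (g : BoundedContinuousFunction ℝ ℝ) :
    Tendsto (fun n => ∫ z, g z ∂μ n) atTop (𝓝 (∫ z, g z ∂ν)) := by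
  let p : Measure ℝ → Measure ℝ := fun m => (m Set.univ + 1)⁻¹ • (m + Measure.dirac 0)
  have hp : ∀ m : Measure ℝ, [IsFiniteMeasure m] → IsProbabilityMeasure (p m) := by
    intro m _
    refine ⟨?_⟩
    simp only [p, Measure.smul_apply, Measure.add_apply, measure_univ, smul_eq_mul]
    exact ENNReal.inv_mul_cancel (by simp) (by simp)
  have hc : ∀ m : Measure ℝ, [IsFiniteMeasure m] → ((m Set.univ + 1)⁻¹).toReal
      = (m.real Set.univ + 1)⁻¹ := by
    intro m _
    rw [ENNReal.toReal_inv, ENNReal.toReal_add (by simp) (by simp)]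
    simp [Measure.real]
  have hint : ∀ m : Measure ℝ, [IsFiniteMeasure m] → ∀ φ : BoundedContinuousFunction ℝ ℝ,
      ∫ z, φ z ∂(p m) = (m.real Set.univ + 1)⁻¹ * (∫ z, φ z ∂m + φ 0) := by
    intro m _ φ
    simp only [p]
    rw [integral_smul_measure, integral_add_measure (φ.integrable _) (φ.integrable _),
      integral_dirac, hc m, smul_eq_mul]
  have hchar : ∀ m : Measure ℝ, [IsFiniteMeasure m] → ∀ v,
      charFun (p m) v = ((m.real Set.univ + 1)⁻¹ : ℝ) * (charFun m v + 1) := by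
    intro m _ v
    have i : ∀ m' : Measure ℝ, [IsFiniteMeasure m'] →
        Integrable (fun x : ℝ => Complex.exp (v * x * Complex.I)) m' := by
      intro m' _
      refine Integrable.of_bound (by fun_prop) 1 (ae_of_all _ fun x => ?_)
      rw [← Complex.ofReal_mul, Complex.norm_exp_ofReal_mul_I]
    simp only [p]
    rw [charFun_apply_real, integral_smul_measure, integral_add_measure (i _) (i _),
      integral_dirac, hc m, charFun_apply_real]
    simp [mul_add]
  have hmass : Tendsto (fun n => (μ n).real Set.univ) atTop (𝓝 (ν.real Set.univ)) := by
    have := h 0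
    simp only [charFun_zero] at this
    exact_mod_cast (Complex.continuous_re.tendsto _).comp this
  have hpos : ∀ m : Measure ℝ, m.real Set.univ + 1 ≠ 0 := fun m => by positivity
  have hmass' := (hmass.add_const 1).inv₀ (hpos ν)
  let pμ : ℕ → ProbabilityMeasure ℝ := fun n => ⟨p (μ n), hp _⟩
  let pν : ProbabilityMeasure ℝ := ⟨p ν, hp _⟩
  have key : Tendsto pμ atTop (𝓝 pν) := by
    refine ProbabilityMeasure.tendsto_iff_tendsto_charFun.2 fun v => ?_
    simp only [pμ, pν, ProbabilityMeasure.coe_mk, hchar]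
    exact ((Complex.continuous_ofReal.tendsto _).comp hmass').mul ((h v).add_const 1)
  have key' := ProbabilityMeasure.tendsto_iff_forall_integral_tendsto.1 key g
  simp only [pμ, pν, ProbabilityMeasure.coe_mk, hint] at key'
  have := ((hmass.add_const 1).mul key').sub_const (g 0)
  simpa [mul_inv_cancel_left₀ (hpos _)] using this

/-- The weight `1 - sin z / z`. It is positive off `0`, of order `z ^ 2` at `0` and bounded below
at infinity, and it is the average of `1 - exp (i u z)` over `u ∈ [-1, 1]`; this last property
expresses the characteristic function of a measure with this density by the one of the measure. -/
noncomputable def weight (z : ℝ) : ℝ := 1 - Real.sinc z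

theorem weight_nonneg (z : ℝ) : 0 ≤ weight z := sub_nonneg.2 (Real.sinc_le_one z)

theorem weight_zero : weight 0 = 0 := by simp [weight]

theorem continuous_weight : Continuous weight := continuous_const.sub Real.continuous_sinc

theorem weight_le_two (z : ℝ) : weight z ≤ 2 := by
  have := Real.neg_one_le_sinc z
  rw [weight]; linarith

theorem weight_pos {z : ℝ} (hz : z ≠ 0) : 0 < weight z := by
  rw [weight, sub_pos, Real.sinc_of_ne_zero hz]
  rcases hz.lt_or_gt with h | h
  · rw [div_lt_one_of_neg h]; exact Real.lt_sin h
  · rw [div_lt_one h]; exact Real.sin_lt h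

theorem half_le_weight {z : ℝ} (hz : 2 ≤ |z|) : 1 / 2 ≤ weight z := by
  have h0 : z ≠ 0 := by rintro rfl; norm_num at hz
  have h1 := Real.sinc_le_inv_abs h0
  have h2 : |z|⁻¹ ≤ 2⁻¹ := inv_anti₀ (by norm_num) hz
  rw [weight]; linarith

theorem abs_weight_div_sq_sub_le {z : ℝ} (h0 : z ≠ 0) (h1 : |z| ≤ 1) :
    |weight z / z ^ 2 - 1 / 6| ≤ |z| := by
  have hb := Real.sin_bound h1
  have e : weight z / z ^ 2 - 1 / 6 = -(Real.sin z - (z - z ^ 3 / 6)) / z ^ 3 := by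
    rw [weight, Real.sinc_of_ne_zero h0]; field_simp; ring
  have hz : 0 < |z| := abs_pos.2 h0
  rw [e, abs_div, abs_neg, abs_pow, div_le_iff₀ (by positivity)]
  refine hb.trans ?_
  have h4 : 0 ≤ |z| ^ 4 := by positivity
  have h5 : |z| ^ 5 ≤ |z| ^ 4 := pow_le_pow_of_le_one hz.le h1 (by norm_num)
  nlinarith

theorem tendsto_weight_div_sq : Tendsto (fun z => weight z / z ^ 2) (𝓝[≠] 0) (𝓝 (1 / 6)) := by
  rw [tendsto_iff_norm_sub_tendsto_zero]
  have h0 : Tendsto (fun z : ℝ => |z|) (𝓝[≠] 0) (𝓝 0) := by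
    have : Tendsto (fun z : ℝ => |z|) (𝓝 0) (𝓝 |0|) := continuous_abs.tendsto 0
    rw [abs_zero] at this
    exact this.mono_left nhdsWithin_le_nhds
  refine squeeze_zero' (Eventually.of_forall fun _ => norm_nonneg _) ?_ h0
  filter_upwards [self_mem_nhdsWithin, h0.eventually (eventually_le_nhds one_pos)] with z hz hz1
  exact abs_weight_div_sq_sub_le hz hz1

theorem weight_le (z : ℝ) : weight z ≤ 2 * min 1 (z ^ 2) := by
  rcases eq_or_ne z 0 with rfl | h0
  · simp [weight_zero]
  rcases le_total |z| 1 with h | h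
  · have h2 : z ^ 2 ≤ 1 := by rw [← sq_abs]; exact pow_le_one₀ (abs_nonneg _) h
    have hb := (abs_le.1 (abs_weight_div_sq_sub_le h0 h)).2
    have hz : 0 < z ^ 2 := by positivity
    have : weight z / z ^ 2 ≤ 2 := by linarith
    rw [div_le_iff₀ hz] at this
    rwa [min_eq_right h2]
  · have h2 : 1 ≤ z ^ 2 := by rw [← sq_abs]; exact one_le_pow₀ h
    rw [min_eq_left h2]; linarith [weight_le_two z]

/-- The measure with density `weight` with respect to `μ`. -/
noncomputable def weighted (μ : Measure ℝ) : Measure ℝ :=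
  μ.withDensity fun z => ENNReal.ofReal (weight z)

theorem integral_weighted {F : Type*} [NormedAddCommGroup F] [NormedSpace ℝ F] (μ : Measure ℝ)
    (g : ℝ → F) : ∫ z, g z ∂weighted μ = ∫ z, weight z • g z ∂μ := by
  rw [weighted, integral_withDensity_eq_integral_toReal_smul₀
    (by have := continuous_weight.measurable; fun_prop) (ae_of_all _ fun _ => by simp)]
  simp [ENNReal.toReal_ofReal (weight_nonneg _)]

theorem charFun_weighted (μ : Measure ℝ) (v : ℝ) :
    charFun (weighted μ) v = ∫ z, weight z * Complex.exp (Complex.I * v * z) ∂μ := by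
  rw [charFun_apply_real, integral_weighted]
  congr with z
  rw [Complex.real_smul]
  ring_nf

theorem isFiniteMeasure_weighted {μ : Measure ℝ}
    (h : ∫⁻ y, ENNReal.ofReal (min 1 (y ^ 2)) ∂μ < ∞) : IsFiniteMeasure (weighted μ) := by
  refine ⟨?_⟩
  rw [weighted, withDensity_apply _ MeasurableSet.univ, Measure.restrict_univ]
  calc ∫⁻ z, ENNReal.ofReal (weight z) ∂μ
      ≤ ∫⁻ z, 2 * ENNReal.ofReal (min 1 (z ^ 2)) ∂μ := by
        refine lintegral_mono fun z => ?_
        rw [show (2 : ℝ≥0∞) = ENNReal.ofReal 2 by simp, ← ENNReal.ofReal_mul (by norm_num)]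
        exact ENNReal.ofReal_le_ofReal (weight_le z)
    _ = 2 * ∫⁻ z, ENNReal.ofReal (min 1 (z ^ 2)) ∂μ := lintegral_const_mul _ (by fun_prop)
    _ < ∞ := ENNReal.mul_lt_top (by simp) h

instance (μ : Measure ℝ) [IsFiniteMeasure μ] : IsFiniteMeasure (weighted μ) := by
  refine isFiniteMeasure_weighted ?_
  calc ∫⁻ y, ENNReal.ofReal (min 1 (y ^ 2)) ∂μ ≤ ∫⁻ _, 1 ∂μ := by
        refine lintegral_mono fun y => ?_
        rw [← ENNReal.ofReal_one]
        exact ENNReal.ofReal_le_ofReal (min_le_left _ _)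
    _ < ∞ := by simp

theorem IsLevyMeasure.integrable_min {π : Measure ℝ} (h : IsLevyMeasure π) :
    Integrable (fun y : ℝ => min 1 (y ^ 2)) π := by
  refine ⟨by fun_prop, ?_⟩
  rw [hasFiniteIntegral_iff_ofReal (ae_of_all _ fun y => by positivity)]
  exact h.2

theorem IsLevyMeasure.sigmaFinite {π : Measure ℝ} (h : IsLevyMeasure π) : SigmaFinite π := by
  refine Measure.sigmaFinite_of_countable
    (S := insert {0} (Set.range fun n : ℕ => {y : ℝ | 1 / ((n : ℝ) + 1) ≤ ‖min 1 (y ^ 2)‖}))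
    ((Set.countable_range _).insert _) ?_ ?_
  · rintro s (rfl | ⟨n, rfl⟩)
    · simp [h.1]
    · exact h.integrable_min.measure_norm_ge_lt_top (by positivity)
  · refine Set.eq_univ_of_forall fun y => ?_
    rcases eq_or_ne y 0 with rfl | hy
    · exact ⟨_, Set.mem_insert _ _, rfl⟩
    · obtain ⟨n, hn⟩ := exists_nat_one_div_lt (K := ℝ) (ε := ‖min 1 (y ^ 2)‖)
        (norm_pos_iff.2 (by positivity))
      exact ⟨_, Set.mem_insert_of_mem _ ⟨n, rfl⟩, hn.le⟩

/-- Averaging the compensated increment `exp (i v y) - exp (i (v + u) y)` over `u ∈ [-1, 1]`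
produces the weight. The compensator is odd in `u` and drops out. -/
theorem integral_increment_kernel (v y c : ℝ) :
    ∫ u in (-1 : ℝ)..1, (Complex.exp (Complex.I * v * y) - Complex.exp (Complex.I * (v + u) * y)
      + Complex.I * u * c) = 2 * (weight y * Complex.exp (Complex.I * v * y)) := by
  have e : ∀ u : ℝ, Complex.exp (Complex.I * v * y) - Complex.exp (Complex.I * (v + u) * y)
      + Complex.I * u * c = Complex.exp (Complex.I * v * y)
        - Complex.exp (Complex.I * v * y) * Complex.exp (u * y * Complex.I)
        + Complex.I * c * u := by
    intro u
    rw [← Complex.exp_add]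
    ring_nf
  have hs : ∫ u in (-1 : ℝ)..1, Complex.exp (u * y * Complex.I) = 2 * (Real.sinc y : ℂ) := by
    have := integral_charFun_Icc (μ := Measure.dirac y) one_pos
    simpa [charFun_apply_real] using this
  have hi : ∫ u in (-1 : ℝ)..1, (u : ℂ) = 0 := by
    rw [intervalIntegral.integral_ofReal, integral_id]; simp
  simp_rw [e]
  rw [intervalIntegral.integral_add (Continuous.intervalIntegrable (by fun_prop) _ _)
      (Continuous.intervalIntegrable (by fun_prop) _ _),
    intervalIntegral.integral_sub (Continuous.intervalIntegrable (by fun_prop) _ _)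
      (Continuous.intervalIntegrable (by fun_prop) _ _),
    intervalIntegral.integral_const_mul, intervalIntegral.integral_const_mul, hs, hi]
  simp only [intervalIntegral.integral_const, weight, Complex.real_smul]
  push_cast
  ring

theorem integrable_increment_kernel {μ : Measure ℝ} [SFinite μ] {c : ℝ → ℝ}
    (hc : Measurable c) (v : ℝ) {B : ℝ → ℝ} (hB : Integrable B μ)
    (hle : ∀ u ∈ Set.uIoc (-1 : ℝ) 1, ∀ y : ℝ,
      ‖Complex.exp (Complex.I * v * y) - Complex.exp (Complex.I * (v + u) * y)
        + Complex.I * u * c y‖ ≤ B y) :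
    Integrable (Function.uncurry fun u y : ℝ => Complex.exp (Complex.I * v * y)
      - Complex.exp (Complex.I * (v + u) * y) + Complex.I * u * c y)
      ((volume.restrict (Set.uIoc (-1 : ℝ) 1)).prod μ) := by
  have : IsFiniteMeasure (volume.restrict (Set.uIoc (-1 : ℝ) 1)) := by
    rw [Set.uIoc_of_le (by norm_num)]; infer_instance
  have hB' : Integrable (fun p : ℝ × ℝ => (1 : ℝ) * B p.2)
      ((volume.restrict (Set.uIoc (-1 : ℝ) 1)).prod μ) :=
    Integrable.mul_prod (integrable_const _) hB
  refine hB'.mono'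
    (by unfold Function.uncurry; exact Measurable.aestronglyMeasurable (by fun_prop)) ?_
  have : ∀ᵐ p : ℝ × ℝ ∂((volume.restrict (Set.uIoc (-1 : ℝ) 1)).prod μ),
      p.1 ∈ Set.uIoc (-1 : ℝ) 1 :=
    Measure.quasiMeasurePreserving_fst.ae (ae_restrict_mem measurableSet_uIoc)
  filter_upwards [this] with p hp
  rw [one_mul]
  exact hle p.1 hp p.2

theorem integral_integral_increment_kernel {μ : Measure ℝ} [SFinite μ] {c : ℝ → ℝ} {v : ℝ}
    (h : Integrable (Function.uncurry fun u y : ℝ => Complex.exp (Complex.I * v * y)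
      - Complex.exp (Complex.I * (v + u) * y) + Complex.I * u * c y)
      ((volume.restrict (Set.uIoc (-1 : ℝ) 1)).prod μ)) :
    ∫ u in (-1 : ℝ)..1, ∫ y, (Complex.exp (Complex.I * v * y)
      - Complex.exp (Complex.I * (v + u) * y) + Complex.I * u * c y) ∂μ
      = 2 * charFun (weighted μ) v := by
  rw [intervalIntegral_integral_swap h]
  simp_rw [integral_increment_kernel, charFun_weighted]
  rw [integral_const_mul]

/-! ### Bounds for the Lévy–Khintchine integrand -/

theorem norm_exp_sub_one_sub_le (t : ℝ) :
    ‖Complex.exp (Complex.I * t) - 1 - Complex.I * t‖ ≤ 3 * t ^ 2 := by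
  have hn : ‖Complex.I * (t : ℂ)‖ = |t| := by simp
  rw [← sq_abs]
  rcases le_total |t| 1 with h | h
  · have := Complex.norm_exp_sub_one_sub_id_le (x := Complex.I * t) (by rwa [hn])
    rw [hn] at this
    nlinarith [sq_nonneg |t|]
  · calc _ ≤ (1 + 1) + |t| := by
          refine (norm_sub_le _ _).trans (add_le_add ((norm_sub_le _ _).trans ?_) hn.le)
          rw [mul_comm, Complex.norm_exp_ofReal_mul_I, norm_one]
      _ ≤ _ := by nlinarith

theorem abs_sub_sin_le (y : ℝ) : |y - Real.sin y| ≤ 3 * y ^ 2 := by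
  have h := (Complex.abs_im_le_norm _).trans (norm_exp_sub_one_sub_le y)
  rw [abs_sub_comm]
  rw [mul_comm, Complex.exp_mul_I] at h
  simpa [← Complex.ofReal_sin, ← Complex.ofReal_cos] using h

/-- A truncation function differs from `sin`, which is another one, by a function that is
integrable for every Lévy measure. -/
theorem exists_abs_sub_sin_le {l : ℝ → ℝ} (hb : ∃ C, ∀ y, |l y| ≤ C)
    (ho : (fun y => l y - y) =O[𝓝 0] (fun y => y ^ 2)) :
    ∃ K, 0 ≤ K ∧ ∀ y, |l y - Real.sin y| ≤ K * min 1 (y ^ 2) := by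
  obtain ⟨C, hC⟩ := hb
  obtain ⟨c, hc, hO⟩ := ho.exists_nonneg
  obtain ⟨δ, hδ, hO⟩ := Metric.eventually_nhds_iff.1 hO.bound
  have hC0 : 0 ≤ C := (abs_nonneg _).trans (hC 0)
  set m := min 1 (δ ^ 2) with hm
  have hm0 : 0 < m := by positivity
  refine ⟨(c + 3) + (C + 1) / m, by positivity, fun y => ?_⟩
  have hd : |l y - Real.sin y| ≤ C + 1 :=
    (abs_sub _ _).trans (add_le_add (hC y) (Real.abs_sin_le_one y))
  have hbig : m ≤ y ^ 2 ∨ 1 ≤ y ^ 2 → |l y - Real.sin y| ≤ (C + 1) / m * min 1 (y ^ 2) := by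
    intro h
    have : m ≤ min 1 (y ^ 2) := by
      rcases h with h | h
      · exact le_min (min_le_left _ _) h
      · rw [min_eq_left h]; exact min_le_left _ _
    rw [div_mul_eq_mul_div, le_div_iff₀ hm0]
    exact mul_le_mul hd this hm0.le (by positivity)
  have hmin : 0 ≤ min 1 (y ^ 2) := by positivity
  rcases le_or_gt m (y ^ 2) with h | h
  · have := hbig (Or.inl h)
    rw [add_mul]
    have : 0 ≤ (c + 3) * min 1 (y ^ 2) := by positivity
    linarith
  · have h1 : y ^ 2 < δ ^ 2 := h.trans_le (min_le_right _ _)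
    have h2 : y ^ 2 ≤ 1 := h.le.trans (min_le_left _ _)
    have h3 := hO (y := y) (by rw [dist_zero_right, Real.norm_eq_abs]; exact abs_lt_of_sq_lt_sq h1 hδ.le)
    rw [min_eq_right h2, add_mul]
    have h4 : |l y - Real.sin y| ≤ |l y - y| + |y - Real.sin y| := abs_sub_le _ _ _
    simp only [Real.norm_eq_abs, abs_of_nonneg (sq_nonneg y)] at h3
    have : 0 ≤ (C + 1) / m * y ^ 2 := by positivity
    linarith [abs_sub_sin_le y]

/-- The integrand of the Lévy–Khintchine formula is dominated by `1 ∧ y ^ 2`, locally uniformly in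
the frequency `v`. -/
theorem exists_norm_levyExponent_integrand_le {l : ℝ → ℝ} (hb : ∃ C, ∀ y, |l y| ≤ C)
    (ho : (fun y => l y - y) =O[𝓝 0] (fun y => y ^ 2)) :
    ∃ K, 0 ≤ K ∧ ∀ v y : ℝ, ‖Complex.exp (Complex.I * v * y) - 1 - Complex.I * v * l y‖
      ≤ K * (1 + |v|) ^ 2 * min 1 (y ^ 2) := by
  obtain ⟨K, hK, h⟩ := exists_abs_sub_sin_le hb ho
  refine ⟨3 + K, by positivity, fun v y => ?_⟩
  have hv := abs_nonneg v
  have hmin : 0 ≤ min 1 (y ^ 2) := by positivity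
  have h1 : ‖Complex.exp (Complex.I * v * y) - 1 - Complex.I * v * Real.sin y‖
      ≤ 3 * (1 + |v|) ^ 2 * min 1 (y ^ 2) := by
    have e : Complex.I * v * y = Complex.I * ((v * y : ℝ) : ℂ) := by push_cast; ring
    rcases le_total (y ^ 2) 1 with hy | hy
    · rw [min_eq_right hy]
      have a1 : ‖Complex.I * v * ((y - Real.sin y : ℝ) : ℂ)‖ ≤ |v| * (3 * y ^ 2) := by
        rw [norm_mul, norm_mul, Complex.norm_I, one_mul, Complex.norm_real, Complex.norm_real]
        exact mul_le_mul_of_nonneg_left (abs_sub_sin_le y) hv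
      have a2 := norm_exp_sub_one_sub_le (v * y)
      calc _ = ‖(Complex.exp (Complex.I * ((v * y : ℝ) : ℂ)) - 1 - Complex.I * ((v * y : ℝ) : ℂ))
                + Complex.I * v * ((y - Real.sin y : ℝ) : ℂ)‖ := by
              rw [e]; congr 1; push_cast; ring
        _ ≤ 3 * (v * y) ^ 2 + |v| * (3 * y ^ 2) := (norm_add_le _ _).trans (add_le_add a2 a1)
        _ ≤ _ := by
          rw [mul_pow, ← sq_abs v]
          nlinarith [sq_nonneg y, mul_nonneg hv (sq_nonneg y)]
    · rw [min_eq_left hy, e]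
      calc _ ≤ ‖Complex.exp (Complex.I * ((v * y : ℝ) : ℂ)) - 1‖ + ‖Complex.I * v * Real.sin y‖ :=
            norm_sub_le _ _
        _ ≤ (1 + 1) + |v| * 1 := by
          refine add_le_add ((norm_sub_le _ _).trans ?_) ?_
          · rw [mul_comm, Complex.norm_exp_ofReal_mul_I, norm_one]
          · rw [norm_mul, norm_mul, Complex.norm_I, one_mul, Complex.norm_real, Complex.norm_real]
            exact mul_le_mul_of_nonneg_left (Real.abs_sin_le_one y) hv
        _ ≤ _ := by nlinarith
  have h2 : ‖Complex.I * v * ((Real.sin y - l y : ℝ) : ℂ)‖ ≤ K * (1 + |v|) ^ 2 * min 1 (y ^ 2) := by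
    rw [norm_mul, norm_mul, Complex.norm_I, one_mul, Complex.norm_real, Complex.norm_real,
      Real.norm_eq_abs, Real.norm_eq_abs, abs_sub_comm]
    calc |v| * |l y - Real.sin y| ≤ (1 + |v|) ^ 2 * (K * min 1 (y ^ 2)) :=
          mul_le_mul (by nlinarith) (h y) (abs_nonneg _) (by positivity)
      _ = _ := by ring
  calc _ = ‖(Complex.exp (Complex.I * v * y) - 1 - Complex.I * v * Real.sin y)
          + Complex.I * v * ((Real.sin y - l y : ℝ) : ℂ)‖ := by congr 1; push_cast; ring
    _ ≤ _ := (norm_add_le _ _).trans (add_le_add h1 h2)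
    _ = _ := by ring

/-! ### Small time limits of weighted laws -/

section

variable {l : ℝ → ℝ} {π : Measure ℝ}

theorem integrable_levyExponent_integrand (hl : Measurable l) (hb : ∃ C, ∀ y, |l y| ≤ C)
    (ho : (fun y => l y - y) =O[𝓝 0] (fun y => y ^ 2)) (hπ : IsLevyMeasure π) (v : ℝ) :
    Integrable (fun y : ℝ => Complex.exp (Complex.I * v * y) - 1 - Complex.I * v * l y) π := by
  obtain ⟨K, hK, h⟩ := exists_norm_levyExponent_integrand_le hb ho
  exact (hπ.integrable_min.const_mul (K * (1 + |v|) ^ 2)).mono'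
    (Measurable.aestronglyMeasurable (by fun_prop)) (ae_of_all _ fun y => h v y)

theorem exists_norm_levyExponent_le (hb : ∃ C, ∀ y, |l y| ≤ C)
    (ho : (fun y => l y - y) =O[𝓝 0] (fun y => y ^ 2)) (hπ : IsLevyMeasure π) (a σ : ℝ) :
    ∃ M, 0 ≤ M ∧ ∀ v, ‖levyExponent l a σ π v‖ ≤ M * (1 + |v|) ^ 2 := by
  obtain ⟨K, hK, h⟩ := exists_norm_levyExponent_integrand_le hb ho
  have hI : 0 ≤ ∫ y, min 1 (y ^ 2) ∂π := integral_nonneg fun y => by positivity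
  refine ⟨|a| + σ ^ 2 / 2 + K * ∫ y, min 1 (y ^ 2) ∂π, by positivity, fun v => ?_⟩
  have hv := abs_nonneg v
  have h1 : ‖Complex.I * a * v‖ ≤ |a| * (1 + |v|) ^ 2 := by
    rw [norm_mul, norm_mul, Complex.norm_I, one_mul, Complex.norm_real, Complex.norm_real]
    exact mul_le_mul_of_nonneg_left (by rw [Real.norm_eq_abs]; nlinarith) (abs_nonneg _)
  have h2 : ‖(σ : ℂ) ^ 2 / 2 * (v : ℂ) ^ 2‖ ≤ σ ^ 2 / 2 * (1 + |v|) ^ 2 := by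
    have e : (σ : ℂ) ^ 2 / 2 * (v : ℂ) ^ 2 = ((σ ^ 2 / 2 * v ^ 2 : ℝ) : ℂ) := by push_cast; ring
    rw [e, Complex.norm_real, Real.norm_of_nonneg (by positivity), ← sq_abs v]
    exact mul_le_mul_of_nonneg_left (by nlinarith) (by positivity)
  have h3 : ‖∫ y : ℝ, (Complex.exp (Complex.I * v * y) - 1 - Complex.I * v * l y) ∂π‖
      ≤ (K * (1 + |v|) ^ 2) * ∫ y, min 1 (y ^ 2) ∂π := by
    rw [← integral_const_mul]
    exact norm_integral_le_of_norm_le (hπ.integrable_min.const_mul _) (ae_of_all _ fun y => h v y)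
  calc _ ≤ (‖Complex.I * a * v‖ + ‖(σ : ℂ) ^ 2 / 2 * (v : ℂ) ^ 2‖) + _ :=
        (norm_add_le _ _).trans (add_le_add_left (norm_sub_le _ _) _)
    _ ≤ _ := add_le_add (add_le_add h1 h2) h3
    _ = _ := by ring

/-- Averaging the increments of the characteristic exponent gives the characteristic function of
a finite measure that determines the Gaussian coefficient and the Lévy measure. -/
theorem integral_levyExponent_sub (hl : Measurable l) (hb : ∃ C, ∀ y, |l y| ≤ C)
    (ho : (fun y => l y - y) =O[𝓝 0] (fun y => y ^ 2)) (hπ : IsLevyMeasure π) (a σ v : ℝ) :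
    ∫ u in (-1 : ℝ)..1, (levyExponent l a σ π v - levyExponent l a σ π (v + u))
      = 2 * ((σ : ℂ) ^ 2 / 6 + charFun (weighted π) v) := by
  have := hπ.sigmaFinite
  have hint := integrable_levyExponent_integrand hl hb ho hπ
  obtain ⟨K, hK, h⟩ := exists_norm_levyExponent_integrand_le hb ho
  have hk : Integrable (Function.uncurry fun u y : ℝ => Complex.exp (Complex.I * v * y)
      - Complex.exp (Complex.I * (v + u) * y) + Complex.I * u * l y)
      ((volume.restrict (Set.uIoc (-1 : ℝ) 1)).prod π) := by
    refine integrable_increment_kernel hl v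
      (hπ.integrable_min.const_mul (K * (1 + |v|) ^ 2 + K * (2 + |v|) ^ 2)) fun u hu y => ?_
    rw [Set.uIoc_of_le (by norm_num)] at hu
    have hu1 : |u| ≤ 1 := abs_le.2 ⟨hu.1.le, hu.2⟩
    have huv : |v + u| ≤ 1 + |v| := (abs_add_le _ _).trans (by linarith)
    have h1 := h v y
    have h2 := h (v + u) y
    have hmin : 0 ≤ min 1 (y ^ 2) := by positivity
    have h3 : K * (1 + |v + u|) ^ 2 * min 1 (y ^ 2) ≤ K * (2 + |v|) ^ 2 * min 1 (y ^ 2) := by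
      gcongr ?_ * ?_ ^ 2 * _
      linarith
    calc _ = ‖(Complex.exp (Complex.I * v * y) - 1 - Complex.I * v * l y) -
          (Complex.exp (Complex.I * (v + u : ℝ) * y) - 1 - Complex.I * (v + u : ℝ) * l y)‖ := by
          congr 1; push_cast; ring
      _ ≤ _ := norm_sub_le _ _
      _ ≤ _ := by rw [add_mul]; linarith
  have e : ∀ u : ℝ, levyExponent l a σ π v - levyExponent l a σ π (v + u)
      = (-(Complex.I * a) * (u : ℂ) + (σ : ℂ) ^ 2 * v * u + (σ : ℂ) ^ 2 / 2 * ((u ^ 2 : ℝ) : ℂ))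
        + ∫ y, (Complex.exp (Complex.I * v * y)
      - Complex.exp (Complex.I * (v + u) * y) + Complex.I * u * l y) ∂π := by
    intro u
    have e2 : ∫ y, (Complex.exp (Complex.I * v * y)
        - Complex.exp (Complex.I * (v + u) * y) + Complex.I * u * l y) ∂π
        = ∫ y : ℝ, (Complex.exp (Complex.I * v * y) - 1 - Complex.I * v * l y) ∂π -
          ∫ y : ℝ, (Complex.exp (Complex.I * (v + u : ℝ) * y) - 1
            - Complex.I * (v + u : ℝ) * l y) ∂π := by
      rw [← integral_sub (hint v) (hint (v + u))]
      congr with y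
      push_cast
      ring
    rw [e2, levyExponent, levyExponent]
    push_cast
    ring
  have hki : IntervalIntegrable (fun u : ℝ => ∫ y, (Complex.exp (Complex.I * v * y)
      - Complex.exp (Complex.I * (v + u) * y) + Complex.I * u * l y) ∂π) volume (-1) 1 := by
    rw [intervalIntegrable_iff]
    exact hk.integral_prod_left
  have hi : ∫ u in (-1 : ℝ)..1, (u : ℂ) = 0 := by
    rw [intervalIntegral.integral_ofReal, integral_id]; simp
  have hi2 : ∫ u in (-1 : ℝ)..1, ((u ^ 2 : ℝ) : ℂ) = 2 / 3 := by
    rw [intervalIntegral.integral_ofReal, integral_pow]; norm_num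
  simp_rw [e]
  rw [intervalIntegral.integral_add (Continuous.intervalIntegrable (by fun_prop) _ _) hki,
    integral_integral_increment_kernel hk,
    intervalIntegral.integral_add (Continuous.intervalIntegrable (by fun_prop) _ _)
      (Continuous.intervalIntegrable (by fun_prop) _ _),
    intervalIntegral.integral_add (Continuous.intervalIntegrable (by fun_prop) _ _)
      (Continuous.intervalIntegrable (by fun_prop) _ _),
    intervalIntegral.integral_const_mul, intervalIntegral.integral_const_mul,
    intervalIntegral.integral_const_mul, hi, hi2]
  ring

theorem integral_charFun_sub (p : Measure ℝ) [IsProbabilityMeasure p] (v : ℝ) :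
    ∫ u in (-1 : ℝ)..1, (charFun p v - charFun p (v + u)) = 2 * charFun (weighted p) v := by
  have hn : ∀ v y : ℝ, ‖Complex.exp (Complex.I * v * y)‖ = 1 := fun v y => by
    rw [show Complex.I * v * y = ((v * y : ℝ) : ℂ) * Complex.I by push_cast; ring,
      Complex.norm_exp_ofReal_mul_I]
  have hi : ∀ v : ℝ, Integrable (fun y : ℝ => Complex.exp (Complex.I * v * y)) p := fun v =>
    Integrable.of_bound (by fun_prop) 1 (ae_of_all _ fun y => (hn v y).le)
  have hk := integrable_increment_kernel (μ := p) (c := fun _ => 0) measurable_const v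
    (B := fun _ => 2) (integrable_const _) (fun u _ y => by
      have h2 := hn (v + u) y
      push_cast at h2
      simp only [Complex.ofReal_zero, mul_zero, add_zero]
      refine (norm_sub_le _ _).trans ?_
      rw [hn v y, h2]; norm_num)
  rw [← integral_integral_increment_kernel hk]
  congr with u
  have h1 := hi (v + u)
  push_cast at h1
  simp only [Complex.ofReal_zero, mul_zero, add_zero]
  rw [integral_sub (hi v) h1, charFun_apply_real, charFun_apply_real]
  congr with y
  · ring_nf
  · push_cast; ring_nf

theorem tendsto_exp_sub_one_div {t : ℕ → ℝ} (ht : ∀ n, 0 < t n) (ht0 : Tendsto t atTop (𝓝 0))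
    (c : ℂ) : Tendsto (fun n => ((t n)⁻¹ : ℂ) * (Complex.exp (t n * c) - 1)) atTop (𝓝 c) := by
  have hd : HasDerivAt (fun s : ℝ => Complex.exp (s * c)) c 0 := by
    have h := (((hasDerivAt_id (0 : ℝ)).ofReal_comp).mul_const c).cexp
    simpa using h
  have := hasDerivAt_iff_tendsto_slope_zero.1 hd
  have ht' : Tendsto t atTop (𝓝[≠] 0) :=
    tendsto_nhdsWithin_iff.2 ⟨ht0, Eventually.of_forall fun n => (ht n).ne'⟩
  simpa [Function.comp_def] using this.comp ht'

theorem norm_exp_sub_one_div_le {t : ℝ} (ht : 0 < t) (ht1 : t ≤ 1) (c : ℂ) :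
    ‖(t⁻¹ : ℂ) * (Complex.exp (t * c) - 1)‖ ≤ ‖c‖ * Real.exp ‖c‖ := by
  have h := Complex.norm_exp_sub_sum_le_norm_mul_exp (t * c) 1
  have hn : ‖(t : ℂ) * c‖ = t * ‖c‖ := by
    rw [norm_mul, Complex.norm_real, Real.norm_of_nonneg ht.le]
  simp only [Finset.range_one, Finset.sum_singleton, pow_zero, Nat.factorial_zero, Nat.cast_one,
    div_one, pow_one, hn] at h
  rw [norm_mul, norm_inv, Complex.norm_real, Real.norm_of_nonneg ht.le, inv_mul_le_iff₀ ht]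
  calc _ ≤ _ := h
    _ ≤ t * ‖c‖ * Real.exp ‖c‖ := by
      gcongr
      exact mul_le_of_le_one_left (norm_nonneg _) ht1
    _ = _ := by ring

/-- If `p n` is the law at time `t n ↓ 0` of a Lévy process with characteristics `(a, σ, π)`, then
the measures with density `weight / t n` with respect to `p n` converge weakly to
`(σ ^ 2 / 6) δ₀` plus the measure with density `weight` with respect to `π`. -/
theorem tendsto_integral_weighted (hl : Measurable l) (hb : ∃ C, ∀ y, |l y| ≤ C)
    (ho : (fun y => l y - y) =O[𝓝 0] (fun y => y ^ 2)) (hπ : IsLevyMeasure π) {a σ : ℝ}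
    {p : ℕ → Measure ℝ} [∀ n, IsProbabilityMeasure (p n)] {t : ℕ → ℝ} (ht : ∀ n, 0 < t n)
    (ht0 : Tendsto t atTop (𝓝 0))
    (hp : ∀ n v, charFun (p n) v = Complex.exp (t n * levyExponent l a σ π v))
    (g : BoundedContinuousFunction ℝ ℝ) :
    Tendsto (fun n => (t n)⁻¹ * ∫ z, g z ∂weighted (p n)) atTop
      (𝓝 (σ ^ 2 / 6 * g 0 + ∫ z, g z ∂weighted π)) := by
  have := isFiniteMeasure_weighted hπ.2
  have hfin : ∀ n, IsFiniteMeasure (ENNReal.ofReal (t n)⁻¹ • weighted (p n)) := fun n =>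
    Measure.smul_finite _ ENNReal.ofReal_ne_top
  have hfin' : IsFiniteMeasure (ENNReal.ofReal (σ ^ 2 / 6) • Measure.dirac (0 : ℝ)) :=
    Measure.smul_finite _ ENNReal.ofReal_ne_top
  have key := tendsto_integral_of_tendsto_charFun
    (μ := fun n => ENNReal.ofReal (t n)⁻¹ • weighted (p n))
    (ν := ENNReal.ofReal (σ ^ 2 / 6) • Measure.dirac 0 + weighted π) ?_ g
  · rw [integral_add_measure (g.integrable _) (g.integrable _)] at key
    simp only [integral_smul_measure, integral_dirac, smul_eq_mul] at key
    rw [ENNReal.toReal_ofReal (by positivity)] at key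
    refine key.congr fun n => ?_
    rw [ENNReal.toReal_ofReal (inv_nonneg.2 (ht n).le)]
  · intro v
    have i : ∀ m' : Measure ℝ, [IsFiniteMeasure m'] →
        Integrable (fun x : ℝ => Complex.exp (v * x * Complex.I)) m' := by
      intro m' _
      refine Integrable.of_bound (by fun_prop) 1 (ae_of_all _ fun x => ?_)
      rw [← Complex.ofReal_mul, Complex.norm_exp_ofReal_mul_I]
    have e1 : charFun (ENNReal.ofReal (σ ^ 2 / 6) • Measure.dirac 0 + weighted π) v
        = 1 / 2 * ∫ u in (-1 : ℝ)..1, (levyExponent l a σ π v - levyExponent l a σ π (v + u)) := by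
      rw [integral_levyExponent_sub hl hb ho hπ, charFun_apply_real,
        integral_add_measure (i _) (i _), integral_smul_measure, integral_dirac,
        ← charFun_apply_real, ENNReal.toReal_ofReal (by positivity)]
      simp
    have e2 : ∀ n, charFun (ENNReal.ofReal (t n)⁻¹ • weighted (p n)) v
        = 1 / 2 * ∫ u in (-1 : ℝ)..1,
          (((t n)⁻¹ : ℂ) * (Complex.exp (t n * levyExponent l a σ π v) - 1)
            - ((t n)⁻¹ : ℂ) * (Complex.exp (t n * levyExponent l a σ π (v + u)) - 1)) := by
      intro n
      rw [charFun_apply_real, integral_smul_measure, ← charFun_apply_real,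
        ENNReal.toReal_ofReal (inv_nonneg.2 (ht n).le)]
      have := integral_charFun_sub (p n) v
      simp_rw [← mul_sub, ← hp, sub_sub_sub_cancel_right]
      rw [intervalIntegral.integral_const_mul, this, Complex.real_smul]
      push_cast
      ring
    rw [e1]
    simp_rw [e2]
    refine Tendsto.const_mul _ ?_
    obtain ⟨M, hM, hle⟩ := exists_norm_levyExponent_le hb ho hπ a σ
    set R : ℝ := M * (2 + |v|) ^ 2
    have hR : ∀ w, |w| ≤ 1 + |v| → ‖levyExponent l a σ π w‖ ≤ R := fun w hw =>
      (hle w).trans (by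
        have := abs_nonneg w
        have : 1 + |w| ≤ 2 + |v| := by linarith
        simp only [R]
        gcongr)
    have hb2 : ∀ n w, t n ≤ 1 → |w| ≤ 1 + |v| → ‖((t n)⁻¹ : ℂ) *
        (Complex.exp (t n * levyExponent l a σ π w) - 1)‖ ≤ R * Real.exp R := by
      intro n w hn hw
      refine (norm_exp_sub_one_div_le (ht n) hn _).trans ?_
      have := hR w hw
      have h0 := norm_nonneg (levyExponent l a σ π w)
      gcongr
    refine intervalIntegral.tendsto_integral_filter_of_dominated_convergence
      (fun _ => R * Real.exp R + R * Real.exp R) ?_ ?_ (by simp) ?_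
    · refine Eventually.of_forall fun n => ?_
      simp_rw [← hp]
      exact Measurable.aestronglyMeasurable (by fun_prop)
    · filter_upwards [ht0.eventually (eventually_le_nhds one_pos)] with n hn
      refine ae_of_all _ fun u hu => ?_
      rw [Set.uIoc_of_le (by norm_num)] at hu
      have hu1 : |u| ≤ 1 := abs_le.2 ⟨hu.1.le, hu.2⟩
      refine (norm_sub_le _ _).trans (add_le_add (hb2 n v hn (by linarith))
        (hb2 n (v + u) hn ((abs_add_le _ _).trans (by linarith))))
    · exact ae_of_all _ fun u _ =>
        (tendsto_exp_sub_one_div ht ht0 _).sub (tendsto_exp_sub_one_div ht ht0 _)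

end

/-! ### Small time limits for functions of class `C²` -/

theorem tendsto_second_order_quotient {h : ℝ → ℝ} (hh : ContDiff ℝ 2 h) (y : ℝ) :
    Tendsto (fun z => (h (y + z) - h y - deriv h y * z) / z ^ 2) (𝓝[≠] 0)
      (𝓝 (deriv (deriv h) y / 2)) := by
  have h1 := taylor_isLittleO_univ (x₀ := y) (n := 2) hh
  have h2 : Tendsto (fun x => (h x - taylorWithinEval h 2 Set.univ y x) / (x - y) ^ 2) (𝓝 y)
      (𝓝 0) := h1.tendsto_div_nhds_zero
  have h3 : Tendsto (fun z : ℝ => y + z) (𝓝[≠] 0) (𝓝 y) := by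
    have : Tendsto (fun z : ℝ => y + z) (𝓝 0) (𝓝 (y + 0)) := (continuous_const_add y).tendsto 0
    rw [add_zero] at this
    exact this.mono_left nhdsWithin_le_nhds
  have h4 := (h2.comp h3).add_const (deriv (deriv h) y / 2)
  rw [zero_add] at h4
  refine h4.congr' ?_
  filter_upwards [self_mem_nhdsWithin] with z hz
  have hz : z ≠ 0 := hz
  simp only [Function.comp_def, taylorWithinEval_succ, taylor_within_zero_eval,
    iteratedDerivWithin_univ, iteratedDeriv_succ, iteratedDeriv_zero, add_sub_cancel_left,
    smul_eq_mul]
  field_simp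
  simp
  ring

/-- The second order remainder of `h` at `y`, compensated by `sin` and divided by the weight. The
value at `0` is the one that makes it continuous. -/
noncomputable def remainder (h : ℝ → ℝ) (y z : ℝ) : ℝ :=
  if z = 0 then 3 * deriv (deriv h) y
  else (h (y + z) - h y - deriv h y * Real.sin z) / weight z

theorem weight_mul_remainder (h : ℝ → ℝ) (y z : ℝ) :
    weight z * remainder h y z = h (y + z) - h y - deriv h y * Real.sin z := by
  rcases eq_or_ne z 0 with rfl | hz
  · simp [weight_zero]
  · rw [remainder, if_neg hz, mul_div_cancel₀ _ (weight_pos hz).ne']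

theorem continuous_remainder {h : ℝ → ℝ} (hh : ContDiff ℝ 2 h) (y : ℝ) :
    Continuous (remainder h y) := by
  have hc := hh.continuous
  have e : ∀ z, z ≠ 0 → remainder h y z =
      (h (y + z) - h y - deriv h y * Real.sin z) / weight z := fun z hz => if_neg hz
  refine continuous_iff_continuousAt.2 fun z => ?_
  rcases eq_or_ne z 0 with rfl | hz
  · rw [continuousAt_iff_punctured_nhds, remainder, if_pos rfl]
    have h1 := tendsto_second_order_quotient hh y
    -- the compensators `z` and `sin z` agree to second order
    have h2 := tendsto_second_order_quotient (h := Real.sin) Real.contDiff_sin 0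
    have h3 := (h1.sub (h2.const_mul (deriv h y))).div tendsto_weight_div_sq (by norm_num)
    simp only [Real.deriv_sin, Real.cos_zero, Real.deriv_cos', Real.sin_zero] at h3
    convert h3.congr' ?_ using 2
    · simp; ring
    · filter_upwards [self_mem_nhdsWithin] with z hz
      have hz : z ≠ 0 := hz
      rw [e z hz, Pi.div_apply, ← mul_div_assoc, div_sub_div_same, div_div_div_cancel_right₀ (by positivity)]
      congr 1
      simp only [zero_add]
      ring
  · refine ContinuousAt.congr ?_ ((isOpen_ne.eventually_mem hz).mono fun w hw => (e w hw).symm)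
    exact ContinuousAt.div (by fun_prop) continuous_weight.continuousAt (weight_pos hz).ne'

theorem exists_abs_remainder_le {h : ℝ → ℝ} (hh : ContDiff ℝ 2 h) (hb : ∃ C, ∀ y, |h y| ≤ C)
    (y : ℝ) : ∃ B, ∀ z, |remainder h y z| ≤ B := by
  obtain ⟨C, hC⟩ := hb
  obtain ⟨B, hB⟩ := (isCompact_Icc (a := (-2 : ℝ)) (b := 2)).exists_bound_of_continuousOn
    (continuous_remainder hh y).continuousOn
  refine ⟨max B (2 * (C + C + |deriv h y|)), fun z => ?_⟩
  rcases le_total |z| 2 with hz | hz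
  · exact (hB z (abs_le.1 hz)).trans (le_max_left _ _)
  · refine le_max_of_le_right ?_
    have hw := half_le_weight hz
    have h0 : z ≠ 0 := by rintro rfl; norm_num at hz
    rw [remainder, if_neg h0, abs_div, abs_of_nonneg (weight_nonneg z),
      div_le_iff₀ (weight_pos h0)]
    have h1 : |h (y + z) - h y - deriv h y * Real.sin z| ≤ C + C + |deriv h y| := by
      refine (abs_sub _ _).trans (add_le_add ((abs_sub _ _).trans (add_le_add (hC _) (hC _))) ?_)
      rw [abs_mul]
      exact mul_le_of_le_one_right (abs_nonneg _) (Real.abs_sin_le_one z)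
    nlinarith [(abs_nonneg _).trans h1]

theorem integrable_sub_sin {l : ℝ → ℝ} {π : Measure ℝ} (hl : Measurable l)
    (hb : ∃ C, ∀ y, |l y| ≤ C) (ho : (fun y => l y - y) =O[𝓝 0] (fun y => y ^ 2))
    (hπ : IsLevyMeasure π) : Integrable (fun z => Real.sin z - l z) π := by
  obtain ⟨K, -, h⟩ := exists_abs_sub_sin_le hb ho
  refine (hπ.integrable_min.const_mul K).mono' (Measurable.aestronglyMeasurable (by fun_prop))
    (ae_of_all _ fun y => ?_)
  rw [Real.norm_eq_abs, abs_sub_comm]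
  exact h y

theorem im_levyExponent_one {l : ℝ → ℝ} {π : Measure ℝ} (hl : Measurable l)
    (hb : ∃ C, ∀ y, |l y| ≤ C) (ho : (fun y => l y - y) =O[𝓝 0] (fun y => y ^ 2))
    (hπ : IsLevyMeasure π) (a σ : ℝ) :
    (levyExponent l a σ π 1).im = a + ∫ z, (Real.sin z - l z) ∂π := by
  have hi := integrable_levyExponent_integrand hl hb ho hπ 1
  have e1 : (∫ y : ℝ, (Complex.exp (Complex.I * (1 : ℝ) * y) - 1
      - Complex.I * (1 : ℝ) * l y) ∂π).im = ∫ z, (Real.sin z - l z) ∂π := by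
    have := integral_im hi
    rw [← RCLike.im_eq_complex_im, ← this]
    congr with y
    rw [Complex.ofReal_one, mul_one, mul_comm, Complex.exp_mul_I]
    simp [← Complex.ofReal_sin, ← Complex.ofReal_cos]
  rw [levyExponent, Complex.add_im, e1]
  simp [← Complex.ofReal_pow]

/-- The small time behaviour of a Lévy process with characteristics `(a, σ, π)` on a bounded
function of class `C²`. No decay of the derivatives is required: the part of the increment
`h (y + z) - h y` that is left after subtracting `h' (y) sin z` is the product of the weight and a
bounded continuous function. -/
theorem tendsto_integral_sub_div {l : ℝ → ℝ} {π : Measure ℝ} (hl : Measurable l)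
    (hb : ∃ C, ∀ y, |l y| ≤ C) (ho : (fun y => l y - y) =O[𝓝 0] (fun y => y ^ 2))
    (hπ : IsLevyMeasure π) {a σ : ℝ}
    {p : ℕ → Measure ℝ} [∀ n, IsProbabilityMeasure (p n)] {t : ℕ → ℝ} (ht : ∀ n, 0 < t n)
    (ht0 : Tendsto t atTop (𝓝 0))
    (hp : ∀ n v, charFun (p n) v = Complex.exp (t n * levyExponent l a σ π v))
    {h : ℝ → ℝ} (hh : ContDiff ℝ 2 h) (hhb : ∃ C, ∀ y, |h y| ≤ C) (y : ℝ) :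
    Integrable (fun z => h (y + z) - h y - deriv h y * l z) π ∧
    Tendsto (fun n => (t n)⁻¹ * (∫ z, h (y + z) ∂p n - h y)) atTop
      (𝓝 (a * deriv h y + σ ^ 2 / 2 * deriv (deriv h) y
        + ∫ z, (h (y + z) - h y - deriv h y * l z) ∂π)) := by
  obtain ⟨B, hB⟩ := exists_abs_remainder_le hh hhb y
  obtain ⟨C, hC⟩ := hhb
  have hhc := hh.continuous
  let g : BoundedContinuousFunction ℝ ℝ :=
    BoundedContinuousFunction.ofNormedAddCommGroup (remainder h y) (continuous_remainder hh y) B hB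
  have hg : ∀ z, g z = remainder h y z := fun _ => rfl
  have hint : Integrable (fun z => h (y + z) - h y - deriv h y * Real.sin z) π := by
    refine (hπ.integrable_min.const_mul (2 * B)).mono'
      (Continuous.aestronglyMeasurable (by fun_prop)) (ae_of_all _ fun z => ?_)
    rw [← weight_mul_remainder, norm_mul, Real.norm_of_nonneg (weight_nonneg z)]
    calc _ ≤ 2 * min 1 (z ^ 2) * B :=
          mul_le_mul (weight_le z) (hB z) (abs_nonneg _) (by positivity)
      _ = _ := by ring
  have hs := integrable_sub_sin hl hb ho hπ
  have esplit : (fun z => h (y + z) - h y - deriv h y * l z) = fun z =>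
      (h (y + z) - h y - deriv h y * Real.sin z) + deriv h y * (Real.sin z - l z) := by
    funext z; ring
  refine ⟨by rw [esplit]; exact hint.add (hs.const_mul _), ?_⟩
  have hsin : Tendsto (fun n => (t n)⁻¹ * ∫ z, Real.sin z ∂p n) atTop
      (𝓝 (a + ∫ z, (Real.sin z - l z) ∂π)) := by
    have h1 := (Complex.continuous_im.tendsto _).comp
      (tendsto_exp_sub_one_div ht ht0 (levyExponent l a σ π 1))
    rw [im_levyExponent_one hl hb ho hπ] at h1
    refine h1.congr fun n => ?_
    have h2 : (charFun (p n) 1).im = ∫ z, Real.sin z ∂p n := by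
      have hi : Integrable (fun z : ℝ => Complex.exp ((1 : ℝ) * z * Complex.I)) (p n) := by
        refine Integrable.of_bound (by fun_prop) 1 (ae_of_all _ fun x => ?_)
        rw [← Complex.ofReal_mul, Complex.norm_exp_ofReal_mul_I]
      rw [charFun_apply_real, ← RCLike.im_eq_complex_im, ← integral_im hi]
      congr with z
      rw [Complex.ofReal_one, one_mul, RCLike.im_eq_complex_im, Complex.exp_ofReal_mul_I_im]
    rw [← h2, hp, Function.comp_apply, ← Complex.ofReal_inv, Complex.im_ofReal_mul]
    simp
  have hG := tendsto_integral_weighted hl hb ho hπ ht ht0 hp g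
  have key := (hsin.const_mul (deriv h y)).add hG
  have eG : ∀ m : Measure ℝ, ∫ z, g z ∂weighted m
      = ∫ z, (h (y + z) - h y - deriv h y * Real.sin z) ∂m := by
    intro m
    rw [integral_weighted]
    congr with z
    rw [hg, smul_eq_mul, weight_mul_remainder]
  have hg0 : g 0 = 3 * deriv (deriv h) y := by rw [hg, remainder, if_pos rfl]
  simp only [eG, hg0] at key
  have elim : deriv h y * (a + ∫ z, (Real.sin z - l z) ∂π) + (σ ^ 2 / 6 * (3 * deriv (deriv h) y)
      + ∫ z, (h (y + z) - h y - deriv h y * Real.sin z) ∂π) =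
      a * deriv h y + σ ^ 2 / 2 * deriv (deriv h) y
        + ∫ z, (h (y + z) - h y - deriv h y * l z) ∂π := by
    rw [esplit, integral_add hint (hs.const_mul _), integral_const_mul]
    ring
  rw [elim] at key
  refine key.congr fun n => ?_
  have i1 : Integrable (fun z => h (y + z)) (p n) :=
    Integrable.of_bound (Continuous.aestronglyMeasurable (by fun_prop)) C
      (ae_of_all _ fun z => hC _)
  have i2 : Integrable Real.sin (p n) :=
    Integrable.of_bound (Continuous.aestronglyMeasurable (by fun_prop)) 1
      (ae_of_all _ fun z => Real.abs_sin_le_one z)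
  have i3 : Integrable (fun z => h (y + z) - h y) (p n) := i1.sub (integrable_const _)
  rw [integral_sub i3 (i2.const_mul _), integral_sub i1 (integrable_const _), integral_const_mul]
  simp
  ring

/-! ### The generator in terms of the characteristics -/

/-- On the functions of class `C²` in its domain, the generator of a Lévy process is the
integro-differential operator given by its characteristics. -/
theorem HasGenerator.eq_of_hasCharacteristics {Ω : Type*} [MeasurableSpace Ω] {P : Measure Ω}
    [IsProbabilityMeasure P] {ξ : ℝ≥0 → Ω → ℝ} (hξ : ∀ t, Measurable (ξ t)) {l : ℝ → ℝ}
    {a σ : ℝ} {π : Measure ℝ} (hl : Measurable l)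
    (hb : ∃ C, ∀ y, |l y| ≤ C) (ho : (fun y => l y - y) =O[𝓝 0] (fun y => y ^ 2))
    (hπ : IsLevyMeasure π) (hchar : HasCharacteristics P ξ l a σ π)
    {h g : ℝ → ℝ} (hg : HasGenerator P (translates ξ) h g)
    (hh : ContDiff ℝ 2 h) (hhb : ∃ C, ∀ y, |h y| ≤ C) (y : ℝ) :
    Integrable (fun z => h (y + z) - h y - deriv h y * l z) π ∧
    g y = a * deriv h y + σ ^ 2 / 2 * deriv (deriv h) y
        + ∫ z, (h (y + z) - h y - deriv h y * l z) ∂π := by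
  let t : ℕ → ℝ≥0 := fun n => ((n : ℝ≥0) + 1)⁻¹
  have htpos : ∀ n, 0 < t n := fun n => by positivity
  have ht0 : Tendsto (fun n => (t n : ℝ)) atTop (𝓝 0) := by
    simpa [t, one_div] using tendsto_one_div_add_atTop_nhds_zero_nat (𝕜 := ℝ)
  have ht : Tendsto t atTop (𝓝[>] 0) :=
    tendsto_nhdsWithin_iff.2 ⟨NNReal.tendsto_coe.1 (by simpa using ht0), Eventually.of_forall htpos⟩
  have : ∀ n, IsProbabilityMeasure (P.map (ξ (t n))) := fun n =>
    Measure.isProbabilityMeasure_map (hξ _).aemeasurable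
  obtain ⟨h1, h2⟩ := tendsto_integral_sub_div hl hb ho hπ (p := fun n => P.map (ξ (t n)))
    (t := fun n => t n) (fun n => by exact_mod_cast htpos n) ht0 (fun n v => hchar (t n) v) hh hhb y
  refine ⟨h1, tendsto_nhds_unique ((hg.2.2.tendsto_at y).comp ht) (h2.congr fun n => ?_)⟩
  have hhc := hh.continuous
  rw [Function.comp_apply, integral_map (hξ _).aemeasurable
    (Continuous.aestronglyMeasurable (by fun_prop))]
  rfl

section ChainRule

variable {f : ℝ → ℝ} {s : ℝ}

theorem contDiff_comp_mul_exp (hf : ContDiffOn ℝ 2 f {0}ᶜ) (hs : s ≠ 0) :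
    ContDiff ℝ 2 fun y => f (s * Real.exp y) := by
  rw [← contDiffOn_univ]
  exact hf.comp (by fun_prop) fun y _ => mul_ne_zero hs (Real.exp_ne_zero y)

theorem deriv_comp_mul_exp (hf : ContDiffOn ℝ 2 f {0}ᶜ) (hs : s ≠ 0) (y : ℝ) :
    deriv (fun y => f (s * Real.exp y)) y = s * Real.exp y * deriv f (s * Real.exp y) := by
  have hx : s * Real.exp y ≠ 0 := mul_ne_zero hs (Real.exp_ne_zero y)
  have h1 : HasDerivAt f (deriv f (s * Real.exp y)) (s * Real.exp y) :=
    ((hf.differentiableOn (by norm_num)).differentiableAt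
      (isOpen_compl_singleton.mem_nhds hx)).hasDerivAt
  rw [mul_comm]
  exact (h1.comp y ((Real.hasDerivAt_exp y).const_mul s)).deriv

theorem deriv_deriv_comp_mul_exp (hf : ContDiffOn ℝ 2 f {0}ᶜ) (hs : s ≠ 0) (y : ℝ) :
    deriv (deriv fun y => f (s * Real.exp y)) y = s * Real.exp y * deriv f (s * Real.exp y)
      + (s * Real.exp y) ^ 2 * deriv (deriv f) (s * Real.exp y) := by
  have hx : s * Real.exp y ≠ 0 := mul_ne_zero hs (Real.exp_ne_zero y)
  have h1 : HasDerivAt (deriv f) (deriv (deriv f) (s * Real.exp y)) (s * Real.exp y) := by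
    have : ContDiffOn ℝ 1 (deriv f) {0}ᶜ :=
      hf.deriv_of_isOpen isOpen_compl_singleton (by norm_num)
    exact ((this.differentiableOn (by norm_num)).differentiableAt
      (isOpen_compl_singleton.mem_nhds hx)).hasDerivAt
  have he := (Real.hasDerivAt_exp y).const_mul s
  rw [funext (deriv_comp_mul_exp hf hs)]
  have := (he.mul (h1.comp y he)).deriv
  simp only [Function.comp_def] at this
  refine this.trans ?_
  ring

end ChainRule

theorem measurableEmbedding_exp : MeasurableEmbedding Real.exp :=
  Real.continuous_exp.measurableEmbedding Real.exp_injective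

theorem exp_preimage_Ioi_zero : Real.exp ⁻¹' Set.Ioi 0 = Set.univ :=
  Set.eq_univ_of_forall Real.exp_pos

/-- The integro-differential operator of a Lévy process acting on `f ∘ (s exp)`, in terms of the
derivatives of `f` at `s exp y` and of the image of the Lévy measure under `exp`. The drift `a`
becomes `a + σ ^ 2 / 2` because of the second derivative of `exp`. -/
theorem integroDifferential_comp_mul_exp {f : ℝ → ℝ} {s : ℝ} (hf : ContDiffOn ℝ 2 f {0}ᶜ)
    (hs : s ≠ 0) (l : ℝ → ℝ) (a σ : ℝ) (π : Measure ℝ) {x y : ℝ} (hx : s * Real.exp y = x)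
    {h : ℝ → ℝ} (hh : h = fun y => f (s * Real.exp y)) :
    (Integrable (fun z => h (y + z) - h y - deriv h y * l z) π →
      IntegrableOn (fun u : ℝ => f (x * u) - f x - x * deriv f x * l (Real.log u))
          (Set.Ioi 0) (π.map Real.exp)) ∧
    a * deriv h y + σ ^ 2 / 2 * deriv (deriv h) y
        + ∫ z, (h (y + z) - h y - deriv h y * l z) ∂π =
      (a + σ ^ 2 / 2) * x * deriv f x + σ ^ 2 / 2 * x ^ 2 * deriv (deriv f) x +
        ∫ u in Set.Ioi (0 : ℝ), (f (x * u) - f x - x * deriv f x * l (Real.log u))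
          ∂(π.map Real.exp) := by
  subst hh hx
  have e : (fun z => f (s * Real.exp (y + z)) - f (s * Real.exp y)
      - deriv (fun y => f (s * Real.exp y)) y * l z) =
      (fun u : ℝ => f (s * Real.exp y * u) - f (s * Real.exp y)
        - s * Real.exp y * deriv f (s * Real.exp y) * l (Real.log u)) ∘ Real.exp := by
    funext z
    rw [deriv_comp_mul_exp hf hs, Function.comp_apply, Real.log_exp, Real.exp_add,
      ← mul_assoc s (Real.exp y) (Real.exp z)]
  constructor
  · intro hi
    rw [measurableEmbedding_exp.integrableOn_map_iff, exp_preimage_Ioi_zero, integrableOn_univ]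
    rwa [e] at hi
  · rw [measurableEmbedding_exp.setIntegral_map, exp_preimage_Ioi_zero, setIntegral_univ,
      deriv_deriv_comp_mul_exp hf hs, e, deriv_comp_mul_exp hf hs]
    simp only [Function.comp_def]
    ring

/-! ### Functions vanishing at infinity on `ℝ \ {0}` -/

theorem IsC0.add {E : Type*} [TopologicalSpace E] {f g : E → ℝ} (hf : IsC0 f) (hg : IsC0 g) :
    IsC0 fun x => f x + g x :=
  ⟨hf.1.add hg.1, by simpa using hf.2.add hg.2⟩

theorem IsC0.sub {E : Type*} [TopologicalSpace E] {f g : E → ℝ} (hf : IsC0 f) (hg : IsC0 g) :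
    IsC0 fun x => f x - g x :=
  ⟨hf.1.sub hg.1, by simpa using hf.2.sub hg.2⟩

theorem IsC0.const_mul {E : Type*} [TopologicalSpace E] {f : E → ℝ} (hf : IsC0 f) (c : ℝ) :
    IsC0 fun x => c * f x :=
  ⟨hf.1.const_mul c, by simpa using hf.2.const_mul c⟩

theorem IsC0.exists_abs_le {f : ℝ → ℝ} (hf : IsC0 f) : ∃ C, 0 ≤ C ∧ ∀ x, |f x| ≤ C := by
  let F : ZeroAtInftyContinuousMap ℝ ℝ := ⟨⟨f, hf.1⟩, hf.2⟩
  refine ⟨‖F.toBCF‖, norm_nonneg _, fun x => F.toBCF.norm_coe_le_norm x⟩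

theorem IsC0.integral_add {Ω : Type*} [MeasurableSpace Ω] {P : Measure Ω} [IsFiniteMeasure P]
    {h : ℝ → ℝ} (hh : IsC0 h) {U : Ω → ℝ} (hU : Measurable U) :
    IsC0 fun y => ∫ ω, h (y + U ω) ∂P := by
  obtain ⟨C, -, hC⟩ := hh.exists_abs_le
  have hc := hh.1
  have hm : ∀ y, AEStronglyMeasurable (fun ω => h (y + U ω)) P := fun y =>
    (hc.measurable.comp (by fun_prop)).aestronglyMeasurable
  constructor
  · exact continuous_of_dominated hm (fun y => ae_of_all _ fun ω => hC _) (integrable_const C)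
      (ae_of_all _ fun ω => by fun_prop)
  · have : (cocompact ℝ).IsCountablyGenerated := by
      rw [cocompact_eq_atBot_atTop]; infer_instance
    rw [show (0 : ℝ) = ∫ _, (0 : ℝ) ∂P by simp]
    refine tendsto_integral_filter_of_dominated_convergence (fun _ => C)
      (Eventually.of_forall hm) (Eventually.of_forall fun y => ae_of_all _ fun ω => hC _)
      (integrable_const C) (ae_of_all _ fun ω => ?_)
    exact hh.2.comp (Homeomorph.addRight (U ω)).isClosedEmbedding.tendsto_cocompact

theorem sgn_mul_exp_log (x : Rstar) : ((sgn x : ℤ) : ℝ) * Real.exp (Real.log |(x : ℝ)|) = x := by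
  rw [Real.exp_log (abs_pos.2 x.2), sgn]
  split_ifs with h
  · simp [abs_of_pos h]
  · simp [abs_of_nonpos (not_lt.1 h)]

theorem eventually_sgn_eq (x : Rstar) : ∀ᶠ y in 𝓝 x, sgn y = sgn x := by
  rcases x.2.lt_or_gt with h | h
  · filter_upwards [continuous_subtype_val.continuousAt.eventually (eventually_lt_nhds h)] with y hy
    rw [sgn, sgn, if_neg (not_lt.2 h.le), if_neg (not_lt.2 hy.le)]
  · filter_upwards [continuous_subtype_val.continuousAt.eventually (eventually_gt_nhds h)] with y hy
    rw [sgn, sgn, if_pos h, if_pos hy]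

theorem continuous_log_abs : Continuous fun x : Rstar => Real.log |(x : ℝ)| :=
  Continuous.log (by fun_prop) fun x => abs_ne_zero.2 x.2

theorem tendsto_log_abs_cocompact :
    Tendsto (fun x : Rstar => Real.log |(x : ℝ)|) (cocompact Rstar) (cocompact ℝ) := by
  have hne : ∀ (s : ℤˣ) (y : ℝ), ((s : ℤ) : ℝ) * Real.exp y ≠ 0 := fun s y =>
    mul_ne_zero (by exact_mod_cast s.ne_zero) (Real.exp_ne_zero y)
  let e : ℤˣ → ℝ → Rstar := fun s y => ⟨_, hne s y⟩
  have he : ∀ s, Continuous (e s) := fun s => by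
    refine Continuous.subtype_mk ?_ _
    fun_prop
  refine (hasBasis_cocompact.tendsto_iff hasBasis_cocompact).2 fun K hK => ?_
  -- the preimage of `K` is covered by its images under `exp` and `-exp`
  refine ⟨e 1 '' K ∪ e (-1) '' K, (hK.image (he 1)).union (hK.image (he (-1))), fun x hx hxK => hx ?_⟩
  have hx' : e (sgn x) (Real.log |(x : ℝ)|) = x := Subtype.ext (sgn_mul_exp_log x)
  rcases Int.units_eq_one_or (sgn x) with h | h <;> rw [h] at hx'
  · exact Or.inl ⟨_, hxK, hx'⟩
  · exact Or.inr ⟨_, hxK, hx'⟩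

/-- In the coordinates `(sgn x, log |x|)`, a function in `C₀(ℝ*)` is a pair of functions in
`C₀(ℝ)`. -/
theorem isC0_comp_log_abs {φ : ℤˣ → ℝ → ℝ} (hφ : ∀ s, IsC0 (φ s)) :
    IsC0 fun x : Rstar => φ (sgn x) (Real.log |(x : ℝ)|) := by
  constructor
  · refine continuous_iff_continuousAt.2 fun x => ?_
    refine ContinuousAt.congr (f := fun y : Rstar => φ (sgn x) (Real.log |(y : ℝ)|))
      ((hφ _).1.comp continuous_log_abs).continuousAt ?_
    filter_upwards [eventually_sgn_eq x] with y hy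
    rw [hy]
  · have h : ∀ s, Tendsto (fun x : Rstar => |φ s (Real.log |(x : ℝ)|)|) (cocompact Rstar) (𝓝 0) :=
      fun s => by simpa using ((hφ s).2.comp tendsto_log_abs_cocompact).abs
    have h2 := (h 1).add (h (-1))
    rw [add_zero] at h2
    refine squeeze_zero_norm (fun x => ?_) h2
    rcases Int.units_eq_one_or (sgn x) with hx | hx <;> rw [hx, Real.norm_eq_abs]
    · exact le_add_of_nonneg_right (abs_nonneg _)
    · exact le_add_of_nonneg_left (abs_nonneg _)

/-! ### Right-continuous paths -/

theorem measurable_eval_index {Ω : Type*} [MeasurableSpace Ω] {k : Ω → ℕ} (hk : Measurable k)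
    {Z : ℕ → Ω → ℝ} (hZ : ∀ n, Measurable (Z n)) : Measurable fun ω => Z (k ω) ω := by
  have h : Measurable (Function.uncurry Z) := measurable_from_prod_countable_right hZ
  exact h.comp (hk.prodMk measurable_id)

theorem aemeasurable_eval_index {Ω : Type*} [MeasurableSpace Ω] {P : Measure Ω} {k : Ω → ℕ}
    (hk : Measurable k) {Z : ℕ → Ω → ℝ} (hZ : ∀ n, AEMeasurable (Z n) P) :
    AEMeasurable (fun ω => Z (k ω) ω) P := by
  refine ⟨fun ω => (hZ (k ω)).mk _ ω, measurable_eval_index hk fun n => (hZ n).measurable_mk, ?_⟩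
  filter_upwards [ae_all_iff.2 fun n => (hZ n).ae_eq_mk] with ω hω
  exact hω _

/-- A process with a.s. càdlàg paths can be evaluated at a random time. -/
theorem aemeasurable_eval {Ω : Type*} [MeasurableSpace Ω] {P : Measure Ω} {ξ : ℝ≥0 → Ω → ℝ}
    (hξ : ∀ t, Measurable (ξ t)) (hc : ∀ᵐ ω ∂P, IsCadlag fun t => ξ t ω) {τ : Ω → ℝ≥0}
    (hτ : Measurable τ) : AEMeasurable (fun ω => ξ (τ ω) ω) P := by
  -- `τ` is approximated from above by times with values in a grid
  let k : ℕ → Ω → ℕ := fun n ω => ⌊((n : ℝ≥0) + 1) * τ ω⌋₊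
  let τ' : ℕ → Ω → ℝ≥0 := fun n ω => ((k n ω : ℝ≥0) + 1) / ((n : ℝ≥0) + 1)
  have hk : ∀ n, Measurable (k n) := fun n => Nat.measurable_floor.comp (hτ.const_mul _)
  have hm : ∀ n, Measurable fun ω => ξ (τ' n ω) ω := by
    intro n
    exact measurable_eval_index (hk n)
      (Z := fun m ω => ξ (((m : ℝ≥0) + 1) / ((n : ℝ≥0) + 1)) ω) fun m => hξ _
  refine aemeasurable_of_tendsto_metrizable_ae atTop (fun n => (hm n).aemeasurable) ?_
  filter_upwards [hc] with ω hω
  have hle : ∀ n, τ ω ≤ τ' n ω := by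
    intro n
    have hn : (0 : ℝ≥0) < (n : ℝ≥0) + 1 := by positivity
    rw [le_div_iff₀ hn, mul_comm]
    exact (Nat.lt_floor_add_one _).le
  have hge : ∀ n, τ' n ω ≤ τ ω + 1 / ((n : ℝ≥0) + 1) := by
    intro n
    have hn : (0 : ℝ≥0) < (n : ℝ≥0) + 1 := by positivity
    rw [div_le_iff₀ hn, add_mul, one_div, inv_mul_cancel₀ hn.ne', mul_comm (τ ω)]
    exact add_le_add_left (Nat.floor_le (by positivity)) 1
  have hlim : Tendsto (fun n => τ' n ω) atTop (𝓝 (τ ω)) := by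
    refine tendsto_of_tendsto_of_tendsto_of_le_of_le tendsto_const_nhds ?_ hle hge
    have h0 : Tendsto (fun n : ℕ => 1 / ((n : ℝ≥0) + 1)) atTop (𝓝 0) := by
      rw [← NNReal.tendsto_coe]
      simpa using tendsto_one_div_add_atTop_nhds_zero_nat (𝕜 := ℝ)
    simpa using h0.const_add (τ ω)
  exact ((hω (τ ω)).1.tendsto).comp
    (tendsto_nhdsWithin_iff.2 ⟨hlim, Eventually.of_forall hle⟩)

/-- The paths that exceed `δ` in absolute value at a rational time before `t`. For a
right-continuous path this means to exceed `δ` at all before `t`; the restriction to rational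
times makes the set measurable. -/
def exceeds (δ : ℝ) (t : ℝ≥0) : Set (ℝ≥0 → ℝ) :=
  ⋃ r : ℚ≥0, {w | (r : ℝ≥0) < t ∧ δ < |w r|}

theorem measurableSet_exceeds (δ : ℝ) (t : ℝ≥0) : MeasurableSet (exceeds δ t) := by
  refine MeasurableSet.iUnion fun r => ?_
  have h : Measurable fun w : ℝ≥0 → ℝ => |w r| := by fun_prop
  exact (MeasurableSet.const _).inter (measurableSet_lt measurable_const h)

theorem exceeds_mono (δ : ℝ) {s t : ℝ≥0} (hst : s ≤ t) : exceeds δ s ⊆ exceeds δ t :=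
  Set.iUnion_mono fun _ _ hw => ⟨hw.1.trans_le hst, hw.2⟩

theorem abs_le_of_notMem_exceeds {w : ℝ≥0 → ℝ} (hw : IsCadlag w) {δ : ℝ} {t u : ℝ≥0}
    (h : w ∉ exceeds δ t) (hu : u < t) : |w u| ≤ δ := by
  by_contra! hlt
  have h1 : ∀ᶠ r in 𝓝[≥] u, δ < |w r| := (hw u).1.abs.eventually (eventually_gt_nhds hlt)
  obtain ⟨v, hv, hv'⟩ := (mem_nhdsGE_iff_exists_Ico_subset' hu).1 h1
  obtain ⟨r, hr3, hr4⟩ : ∃ r : ℚ≥0, u < (r : ℝ≥0) ∧ (r : ℝ≥0) < min v t := by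
    obtain ⟨q, hq0, hq⟩ := (NNReal.lt_iff_exists_rat_btwn _ _).1 (lt_min hv hu)
    lift q to ℚ≥0 using hq0
    refine ⟨q, ?_⟩
    have e : Real.toNNReal ((q : ℚ) : ℝ) = (q : ℝ≥0) :=
      NNReal.eq (by rw [Real.coe_toNNReal _ (by positivity)]; rfl)
    rwa [e] at hq
  exact h (Set.mem_iUnion.2 ⟨r, hr4.trans_le (min_le_right _ _),
    hv' ⟨hr3.le, hr4.trans_le (min_le_left _ _)⟩⟩)

/-- A càdlàg process started at `0` stays near `0` for a short time, with high probability. -/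
theorem tendsto_measureReal_exceeds {Ω : Type*} [MeasurableSpace Ω] {P : Measure Ω}
    [IsFiniteMeasure P] {ξ : ℝ≥0 → Ω → ℝ} (hξ : IsLevyProcess P ξ) {δ : ℝ} (hδ : 0 < δ) :
    Tendsto (fun t => P.real {ω | (fun r => ξ r ω) ∈ exceeds δ t}) (𝓝[>] 0) (𝓝 0) := by
  have hpath : Measurable fun ω r => ξ r ω := measurable_pi_lambda _ hξ.measurable
  have key := tendsto_measure_biInter_gt (μ := P) (a := (0 : ℝ≥0))
    (s := fun t => {ω | (fun r => ξ r ω) ∈ exceeds δ t})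
    (fun t _ => (hpath (measurableSet_exceeds δ t)).nullMeasurableSet)
    (fun s t _ hst ω hω => exceeds_mono δ hst hω) ⟨1, one_pos, measure_ne_top _ _⟩
  have hnull : P (⋂ t > (0 : ℝ≥0), {ω | (fun r => ξ r ω) ∈ exceeds δ t}) = 0 := by
    have : ∀ᵐ ω ∂P, ω ∉ ⋂ t > (0 : ℝ≥0), {ω | (fun r => ξ r ω) ∈ exceeds δ t} := by
      filter_upwards [hξ.zero, hξ.cadlag] with ω h0 hω hmem
      have h1 : ∀ᶠ r in 𝓝[≥] (0 : ℝ≥0), |ξ r ω| < δ :=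
        (hω 0).1.abs.eventually (eventually_lt_nhds (by simpa [h0] using hδ))
      obtain ⟨v, hv, hv'⟩ := (mem_nhdsGE_iff_exists_Ico_subset' one_pos).1 h1
      have h2 := Set.mem_iInter₂.1 hmem v hv
      obtain ⟨r, hr1, hr2⟩ := Set.mem_iUnion.1 h2
      exact lt_asymm hr2 (hv' ⟨zero_le, hr1⟩)
    exact measure_eq_zero_iff_ae_notMem.2 this
  rw [hnull] at key
  simpa [Measure.real, Function.comp_def] using
    (ENNReal.tendsto_toReal ENNReal.zero_ne_top).comp key

/-! ### The Lamperti–Kiu process up to the first changes of sign -/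

namespace Data

variable {Ω : Type*} [MeasurableSpace Ω] {P : Measure Ω} (D : Data P)

theorem sign_zero (x : Rstar) : sign x 0 = sgn x := by simp [sign]

theorem sign_one (x : Rstar) : sign x 1 = -sgn x := by simp [sign]

theorem measurable_T (x : Rstar) (n : ℕ) : Measurable (D.T x n) :=
  Finset.measurable_fun_sum _ fun _ _ => D.measurable_ζ _ _

theorem T_mono (x : Rstar) (ω : Ω) : Monotone fun n => D.T x n ω := fun _ _ h =>
  Finset.sum_le_sum_of_subset (Finset.range_mono h)

theorem N_eq {x : Rstar} {t : ℝ≥0} {ω : Ω} {n : ℕ} (h1 : D.T x n ω ≤ t) (h2 : t < D.T x (n + 1) ω) :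
    D.N x t ω = n := by
  have : {n | D.T x n ω ≤ t} = Set.Iic n := by
    ext m
    refine ⟨fun hm => ?_, fun hm => (D.T_mono x ω hm).trans h1⟩
    by_contra hlt
    exact absurd (h2.trans_le ((D.T_mono x ω (Nat.succ_le_of_lt (not_le.1 hlt))).trans hm))
      (lt_irrefl _)
  rw [N, this, csSup_Iic]

theorem N_eq_succ_iff {x : Rstar} {t : ℝ≥0} {ω : Ω} {n : ℕ} :
    D.N x t ω = n + 1 ↔ D.T x (n + 1) ω ≤ t ∧ t < D.T x (n + 2) ω := by
  refine ⟨fun h => ?_, fun h => D.N_eq h.1 h.2⟩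
  -- a positive value of `N` excludes the unbounded case, where `sSup` is `0`
  have hb : BddAbove {n | D.T x n ω ≤ t} := by
    by_contra hb
    rw [N, Nat.sSup_of_not_bddAbove hb] at h
    omega
  have hne : {n | D.T x n ω ≤ t}.Nonempty := ⟨0, by simp [T]⟩
  have hmem := Nat.sSup_mem hne hb
  change D.T x (D.N x t ω) ω ≤ t at hmem
  rw [h] at hmem
  refine ⟨hmem, ?_⟩
  by_contra hlt
  have h2 : n + 2 ≤ D.N x t ω := le_csSup hb (not_lt.1 hlt)
  omega

theorem measurable_N (x : Rstar) (t : ℝ≥0) : Measurable (D.N x t) := by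
  have hs : ∀ n, MeasurableSet (D.N x t ⁻¹' {n + 1}) := by
    intro n
    have : D.N x t ⁻¹' {n + 1} = {ω | D.T x (n + 1) ω ≤ t} ∩ {ω | t < D.T x (n + 2) ω} :=
      Set.ext fun ω => D.N_eq_succ_iff
    rw [this]
    exact (measurableSet_le (D.measurable_T _ _) measurable_const).inter
      (measurableSet_lt measurable_const (D.measurable_T _ _))
  refine measurable_to_countable' fun n => ?_
  cases n with
  | succ n => exact hs n
  | zero =>
    have : D.N x t ⁻¹' {0} = (⋃ n, D.N x t ⁻¹' {n + 1})ᶜ := by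
      ext ω
      simp only [Set.mem_preimage, Set.mem_singleton_iff, Set.mem_compl_iff, Set.mem_iUnion,
        not_exists]
      refine ⟨fun h n => by omega, fun h => ?_⟩
      rcases Nat.exists_eq_add_one_of_ne_zero.mt (not_exists.2 h) with h'
      exact not_not.1 h'
    rw [this]
    exact (MeasurableSet.iUnion hs).compl

theorem aemeasurable_Y (x : Rstar) (t : ℝ≥0) : AEMeasurable (fun ω => (D.Y x t ω : ℝ)) P := by
  have hexp : ∀ n, AEMeasurable (fun ω => (x : ℝ) * (Real.exp
      (D.ξ (sign x n) n (t - (D.T x n ω).toNNReal) ω + ∑ k ∈ Finset.range n,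
        (D.ξ (sign x k) k (D.ζ (sign x k) k ω).toNNReal ω + D.U (sign x k) k ω)) * (-1) ^ n)) P := by
    intro n
    have h1 : AEMeasurable (fun ω => D.ξ (sign x n) n (t - (D.T x n ω).toNNReal) ω) P :=
      aemeasurable_eval (D.levy _ _).measurable (D.levy _ _).cadlag
        (measurable_const.sub (D.measurable_T x n).ennreal_toNNReal)
    have h2 : ∀ k, AEMeasurable (fun ω => D.ξ (sign x k) k (D.ζ (sign x k) k ω).toNNReal ω
        + D.U (sign x k) k ω) P := fun k =>
      (aemeasurable_eval (D.levy _ _).measurable (D.levy _ _).cadlag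
        (D.measurable_ζ _ _).ennreal_toNNReal).add (D.measurable_U _ _).aemeasurable
    exact ((Real.measurable_exp.comp_aemeasurable
      (h1.add (Finset.aemeasurable_fun_sum _ fun k _ => h2 k))).mul_const _).const_mul _
  exact aemeasurable_eval_index (D.measurable_N x t) hexp

theorem Y_of_lt {x : Rstar} {t : ℝ≥0} {ω : Ω} (h : t < D.ζ (sgn x) 0 ω) :
    (D.Y x t ω : ℝ) = x * Real.exp (D.ξ (sgn x) 0 t ω) := by
  have hN : D.N x t ω = 0 := D.N_eq (by simp [T]) (by simpa [T, sign_zero] using h)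
  simp [Y, expo, age, hN, T, sign_zero]

theorem Y_of_le_of_lt {x : Rstar} {t : ℝ≥0} {ω : Ω} (h1 : D.ζ (sgn x) 0 ω ≤ t)
    (h2 : t < D.ζ (-sgn x) 1 ω) :
    (D.Y x t ω : ℝ) = -x * Real.exp (D.ξ (-sgn x) 1 (t - (D.ζ (sgn x) 0 ω).toNNReal) ω +
      (D.ξ (sgn x) 0 (D.ζ (sgn x) 0 ω).toNNReal ω + D.U (sgn x) 0 ω)) := by
  have hN : D.N x t ω = 1 := by
    refine D.N_eq (by simpa [T, sign_zero] using h1) ?_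
    simp only [T, Finset.sum_range_succ, Finset.sum_range_zero, zero_add, sign_zero, sign_one]
    exact h2.trans_le le_add_self
  simp [Y, expo, age, hN, T, sign_zero, sign_one]

end Data

theorem setIntegral_eq_of_indepFun {Ω α β : Type*} [MeasurableSpace Ω] [MeasurableSpace α]
    [MeasurableSpace β] {P : Measure Ω} [IsProbabilityMeasure P] {Z : Ω → α} {X : Ω → β}
    (h : IndepFun Z X P) (hZ : Measurable Z) (hX : Measurable X) {S : Set α}
    (hS : MeasurableSet S) {φ : β → ℝ} (hφ : Measurable φ) :
    ∫ ω in Z ⁻¹' S, φ (X ω) ∂P = P.real (Z ⁻¹' S) * ∫ ω, φ (X ω) ∂P := by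
  have hm : Measurable (S.indicator (1 : α → ℝ)) := measurable_one.indicator hS
  have h2 := (h.comp hm hφ).integral_fun_mul_eq_mul_integral
    (hm.comp hZ).aestronglyMeasurable (hφ.comp hX).aestronglyMeasurable
  have e : ∀ ω, S.indicator (1 : α → ℝ) (Z ω) = (Z ⁻¹' S).indicator 1 ω := fun ω => rfl
  simp only [Function.comp_apply, e] at h2
  rw [integral_indicator_one (hZ hS)] at h2
  rw [← h2, ← integral_indicator (hZ hS)]
  congr with ω
  by_cases hω : ω ∈ Z ⁻¹' S <;> simp [hω]

theorem measureReal_inter_of_indepFun {Ω α β : Type*} [MeasurableSpace Ω] [MeasurableSpace α]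
    [MeasurableSpace β] {P : Measure Ω} {Z : Ω → α} {X : Ω → β}
    (h : IndepFun Z X P) {S : Set α} {T : Set β} (hS : MeasurableSet S) (hT : MeasurableSet T) :
    P.real (Z ⁻¹' S ∩ X ⁻¹' T) = P.real (Z ⁻¹' S) * P.real (X ⁻¹' T) := by
  rw [Measure.real, h.measure_inter_preimage_eq_mul _ _ hS hT, ENNReal.toReal_mul]; rfl

namespace Data

variable {Ω : Type*} [MeasurableSpace Ω] {P : Measure Ω} (D : Data P)

theorem measurable_path (s : ℤˣ) (k : ℕ) : Measurable fun ω t => D.ξ s k t ω :=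
  measurable_pi_lambda _ (D.levy s k).measurable

theorem measureReal_ζ_gt (s : ℤˣ) (k : ℕ) (t : ℝ≥0) :
    P.real (D.ζ s k ⁻¹' Set.Ioi (t : ℝ≥0∞)) = Real.exp (-(D.q s * t)) := by
  have := D.exponential s k t
  rw [Measure.real]
  change (P {ω | (t : ℝ≥0∞) < D.ζ s k ω}).toReal = _
  rw [this, ENNReal.toReal_ofReal (Real.exp_pos _).le]

theorem measureReal_ζ_le [IsProbabilityMeasure P] (s : ℤˣ) (k : ℕ) (t : ℝ≥0) :
    P.real (D.ζ s k ⁻¹' Set.Iic (t : ℝ≥0∞)) = 1 - Real.exp (-(D.q s * t)) := by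
  rw [← Set.compl_Ioi, Set.preimage_compl,
    probReal_compl_eq_one_sub (D.measurable_ζ s k measurableSet_Ioi), measureReal_ζ_gt]

/-- A bound for the probability that, by time `t`, a second change of sign occurs or one of the two
Lévy processes involved so far leaves `[-δ, δ]`. -/
def deviation (s : ℤˣ) (δ : ℝ) (t : ℝ≥0) : ℝ :=
  P.real (D.ζ (-s) 1 ⁻¹' Set.Iic (t : ℝ≥0∞)) +
    P.real ((fun ω r => D.ξ s 0 r ω) ⁻¹' exceeds δ (2 * t)) +
    P.real ((fun ω r => D.ξ (-s) 1 r ω) ⁻¹' exceeds δ (2 * t))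

theorem tendsto_one_sub_exp (s : ℤˣ) :
    Tendsto (fun t : ℝ≥0 => 1 - Real.exp (-(D.q s * t))) (𝓝[>] 0) (𝓝 0) := by
  have h : Continuous fun t : ℝ≥0 => 1 - Real.exp (-(D.q s * t)) := by fun_prop
  have := h.tendsto 0
  simp only [NNReal.coe_zero, mul_zero, neg_zero, Real.exp_zero, sub_self] at this
  exact this.mono_left nhdsWithin_le_nhds

theorem tendsto_deviation [IsProbabilityMeasure P] (s : ℤˣ) {δ : ℝ} (hδ : 0 < δ) :
    Tendsto (D.deviation s δ) (𝓝[>] 0) (𝓝 0) := by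
  have h2 : Tendsto (fun t : ℝ≥0 => 2 * t) (𝓝[>] 0) (𝓝[>] 0) := by
    refine tendsto_nhdsWithin_iff.2 ⟨?_, ?_⟩
    · have h : Continuous fun t : ℝ≥0 => 2 * t := by fun_prop
      have := h.tendsto 0
      rw [mul_zero] at this
      exact this.mono_left nhdsWithin_le_nhds
    · filter_upwards [self_mem_nhdsWithin] with t ht
      exact mul_pos two_pos (Set.mem_Ioi.1 ht)
  have a1 := D.tendsto_one_sub_exp (-s)
  simp_rw [← D.measureReal_ζ_le (-s) 1] at a1
  have a2 := (tendsto_measureReal_exceeds (D.levy s 0) hδ).comp h2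
  have a3 := (tendsto_measureReal_exceeds (D.levy (-s) 1) hδ).comp h2
  have key := (a1.add a2).add a3
  simp only [add_zero] at key
  exact key

/-- On the event that a change of sign occurs before time `t`, the value `f (Y_t)` may be replaced
by `f (-x exp U)`: outside an event of small conditional probability there is a single change of
sign and the Lévy processes have hardly moved. -/
theorem abs_setIntegral_sub_le [IsProbabilityMeasure P] {f : ℝ → ℝ} {C : ℝ} (hC : ∀ x, |f x| ≤ C)
    {s : ℤˣ} {ε δ : ℝ} (hε : 0 ≤ ε)
    (hδ : ∀ y z, |z| ≤ 2 * δ → |f (((-s : ℤˣ) : ℤ) * Real.exp (y + z)) -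
      f (((-s : ℤˣ) : ℤ) * Real.exp y)| ≤ ε) {x : Rstar} (hx : sgn x = s) {t : ℝ≥0} (ht : 0 < t) :
    |∫ ω in D.ζ s 0 ⁻¹' Set.Iic (t : ℝ≥0∞), (f (D.Y x t ω) - f (-x * Real.exp (D.U s 0 ω))) ∂P| ≤
      (1 - Real.exp (-(D.q s * t))) * (ε + 2 * C * D.deviation s δ t) := by
  set B := D.ζ s 0 ⁻¹' Set.Iic (t : ℝ≥0∞) with hB
  set E := D.ζ (-s) 1 ⁻¹' Set.Iic (t : ℝ≥0∞) with hE
  set E0 := (fun ω r => D.ξ s 0 r ω) ⁻¹' exceeds δ (2 * t) with hE0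
  set E1 := (fun ω r => D.ξ (-s) 1 r ω) ⁻¹' exceeds δ (2 * t) with hE1
  have hC0 : 0 ≤ C := (abs_nonneg _).trans (hC 0)
  have mB : MeasurableSet B := D.measurable_ζ s 0 measurableSet_Iic
  have mE : MeasurableSet E := D.measurable_ζ (-s) 1 measurableSet_Iic
  have mE0 : MeasurableSet E0 := D.measurable_path s 0 (measurableSet_exceeds _ _)
  have mE1 : MeasurableSet E1 := D.measurable_path (-s) 1 (measurableSet_exceeds _ _)
  have hne : ((s, 0) : ℤˣ × ℕ) ≠ (-s, 1) := by simp
  have hind := D.indep.indepFun hne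
  have iE : P.real (B ∩ E) = P.real B * P.real E :=
    measureReal_inter_of_indepFun (hind.comp (measurable_fst.comp measurable_snd)
      (measurable_fst.comp measurable_snd)) measurableSet_Iic measurableSet_Iic
  have iE0 : P.real (B ∩ E0) = P.real B * P.real E0 :=
    measureReal_inter_of_indepFun ((D.indep_ξ s 0).symm.comp measurable_fst measurable_id)
      measurableSet_Iic (measurableSet_exceeds _ _)
  have iE1 : P.real (B ∩ E1) = P.real B * P.real E1 :=
    measureReal_inter_of_indepFun (hind.comp (measurable_fst.comp measurable_snd)
      measurable_fst) measurableSet_Iic (measurableSet_exceeds _ _)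
  have hbound : ∀ᵐ ω ∂P, ω ∈ B → ‖f (D.Y x t ω) - f (-x * Real.exp (D.U s 0 ω))‖ ≤
      ε + (2 * C * E.indicator 1 ω + 2 * C * E0.indicator 1 ω + 2 * C * E1.indicator 1 ω) := by
    filter_upwards [(D.levy s 0).cadlag, (D.levy (-s) 1).cadlag] with ω c0 c1 hω
    have hn : ∀ S : Set Ω, 0 ≤ 2 * C * S.indicator (1 : Ω → ℝ) ω := fun S =>
      mul_nonneg (by positivity) (Set.indicator_nonneg (fun _ _ => zero_le_one) _)
    have hle : ‖f (D.Y x t ω) - f (-x * Real.exp (D.U s 0 ω))‖ ≤ 2 * C := by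
      rw [Real.norm_eq_abs, two_mul]
      exact (abs_sub _ _).trans (add_le_add (hC _) (hC _))
    by_cases h : ω ∈ E
    · have : E.indicator (1 : Ω → ℝ) ω = 1 := Set.indicator_of_mem h _
      rw [this]; linarith [hn E0, hn E1]
    by_cases h0 : ω ∈ E0
    · have : E0.indicator (1 : Ω → ℝ) ω = 1 := Set.indicator_of_mem h0 _
      rw [this]; linarith [hn E, hn E1]
    by_cases h1 : ω ∈ E1
    · have : E1.indicator (1 : Ω → ℝ) ω = 1 := Set.indicator_of_mem h1 _
      rw [this]; linarith [hn E0, hn E]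
    refine le_add_of_le_of_nonneg ?_ (by linarith [hn E, hn E0, hn E1])
    have hω : D.ζ s 0 ω ≤ t := hω
    have hE' : t < D.ζ (-s) 1 ω := not_le.1 h
    have hτ : (D.ζ s 0 ω).toNNReal ≤ t := by
      simpa using ENNReal.toNNReal_mono ENNReal.coe_ne_top hω
    have ht2 : t < 2 * t := by rw [two_mul]; exact lt_add_of_pos_left t ht
    have b0 := abs_le_of_notMem_exceeds c0 h0 (hτ.trans_lt ht2)
    have b1 := abs_le_of_notMem_exceeds c1 h1
      ((tsub_le_self (a := t) (b := (D.ζ s 0 ω).toNNReal)).trans_lt ht2)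
    have hY := D.Y_of_le_of_lt (x := x) (by rw [hx]; exact hω) (by rw [hx]; exact hE')
    rw [hx] at hY
    have hx' : (((-s : ℤˣ) : ℤ) : ℝ) * Real.exp (Real.log |(x : ℝ)|) = -x := by
      rw [Units.val_neg, Int.cast_neg, neg_mul, ← hx, sgn_mul_exp_log]
    have := hδ (Real.log |(x : ℝ)| + D.U s 0 ω) (D.ξ (-s) 1 (t - (D.ζ s 0 ω).toNNReal) ω +
      D.ξ s 0 (D.ζ s 0 ω).toNNReal ω) ((abs_add_le _ _).trans (by linarith))
    simp only [Real.exp_add, ← mul_assoc, hx'] at this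
    have e : (D.Y x t ω : ℝ) = -x * Real.exp (D.U s 0 ω) *
        Real.exp (D.ξ (-s) 1 (t - (D.ζ s 0 ω).toNNReal) ω) *
        Real.exp (D.ξ s 0 (D.ζ s 0 ω).toNNReal ω) := by
      rw [hY, Real.exp_add, Real.exp_add]; ring
    rw [e, Real.norm_eq_abs]
    exact this
  have hi : ∀ S : Set Ω, MeasurableSet S →
      Integrable (fun ω => 2 * C * S.indicator (1 : Ω → ℝ) ω) (P.restrict B) := fun S hS =>
    ((integrable_const (1 : ℝ)).indicator hS).const_mul _
  have hI : ∀ S : Set Ω, MeasurableSet S →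
      ∫ ω in B, 2 * C * S.indicator (1 : Ω → ℝ) ω ∂P = 2 * C * P.real (B ∩ S) := fun S hS => by
    rw [integral_const_mul, integral_indicator_one hS, measureReal_restrict_apply hS,
      Set.inter_comm]
  have i3 : Integrable (fun ω => 2 * C * E.indicator (1 : Ω → ℝ) ω +
      2 * C * E0.indicator (1 : Ω → ℝ) ω) (P.restrict B) := (hi E mE).add (hi E0 mE0)
  have i4 : Integrable (fun ω => 2 * C * E.indicator (1 : Ω → ℝ) ω +
      2 * C * E0.indicator (1 : Ω → ℝ) ω + 2 * C * E1.indicator (1 : Ω → ℝ) ω) (P.restrict B) :=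
    i3.add (hi E1 mE1)
  have hint : Integrable (fun ω => ε + (2 * C * E.indicator (1 : Ω → ℝ) ω +
      2 * C * E0.indicator (1 : Ω → ℝ) ω + 2 * C * E1.indicator (1 : Ω → ℝ) ω)) (P.restrict B) :=
    (integrable_const _).add i4
  have hfin := norm_integral_le_of_norm_le hint ((ae_restrict_iff' mB).2 hbound)
  rw [Real.norm_eq_abs] at hfin
  refine hfin.trans (le_of_eq ?_)
  rw [integral_add (integrable_const _) i4,
    integral_add i3 (hi E1 mE1), integral_add (hi E mE) (hi E0 mE0), hI E mE, hI E0 mE0, hI E1 mE1,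
    iE, iE0, iE1, ← D.measureReal_ζ_le s 0, deviation]
  simp
  ring

/-! ### The generator of the Lamperti–Kiu process -/

theorem integral_comp_Y [IsProbabilityMeasure P] {f : ℝ → ℝ} (hf : Continuous f) {C : ℝ} (hC : ∀ x, |f x| ≤ C)
    {s : ℤˣ} {x : Rstar} (hx : sgn x = s) (t : ℝ≥0) :
    ∫ ω, f (D.Y x t ω) ∂P =
      Real.exp (-(D.q s * t)) * ∫ ω, f (x * Real.exp (D.ξ s 0 t ω)) ∂P +
      (1 - Real.exp (-(D.q s * t))) * ∫ ω, f (-x * Real.exp (D.U s 0 ω)) ∂P +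
      ∫ ω in D.ζ s 0 ⁻¹' Set.Iic (t : ℝ≥0∞),
        (f (D.Y x t ω) - f (-x * Real.exp (D.U s 0 ω))) ∂P := by
  have hfm := hf.measurable
  have iY : Integrable (fun ω => f (D.Y x t ω)) P :=
    Integrable.of_bound (hfm.comp_aemeasurable (D.aemeasurable_Y x t)).aestronglyMeasurable C
      (ae_of_all _ fun ω => hC _)
  have hU := D.measurable_U s 0
  have iU : Integrable (fun ω => f (-x * Real.exp (D.U s 0 ω))) P :=
    Integrable.of_bound (Measurable.aestronglyMeasurable (by fun_prop)) C
      (ae_of_all _ fun ω => hC _)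
  have mA : MeasurableSet (D.ζ s 0 ⁻¹' Set.Ioi (t : ℝ≥0∞)) := D.measurable_ζ s 0 measurableSet_Ioi
  have hA : ∫ ω in D.ζ s 0 ⁻¹' Set.Ioi (t : ℝ≥0∞), f (D.Y x t ω) ∂P =
      Real.exp (-(D.q s * t)) * ∫ ω, f (x * Real.exp (D.ξ s 0 t ω)) ∂P := by
    have hi : IndepFun (D.ζ s 0) (D.ξ s 0 t) P :=
      (D.indep_ξ s 0).symm.comp measurable_fst (measurable_pi_apply t)
    rw [← D.measureReal_ζ_gt s 0 t, ← setIntegral_eq_of_indepFun hi (D.measurable_ζ s 0)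
      ((D.levy s 0).measurable t) measurableSet_Ioi (φ := fun z => f (x * Real.exp z))
      (by fun_prop)]
    refine setIntegral_congr_fun mA fun ω hω => ?_
    rw [D.Y_of_lt (by rw [hx]; exact hω), hx]
  have hB : ∫ ω in D.ζ s 0 ⁻¹' Set.Iic (t : ℝ≥0∞), f (-x * Real.exp (D.U s 0 ω)) ∂P =
      (1 - Real.exp (-(D.q s * t))) * ∫ ω, f (-x * Real.exp (D.U s 0 ω)) ∂P := by
    rw [← D.measureReal_ζ_le s 0 t]
    exact setIntegral_eq_of_indepFun (D.indep_ζ s 0) (D.measurable_ζ s 0) hU measurableSet_Iic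
      (φ := fun z => f (-x * Real.exp z)) (by fun_prop)
  rw [integral_sub iY.integrableOn iU.integrableOn, hB, ← hA, ← integral_add_compl mA iY,
    ← Set.preimage_compl, Set.compl_Ioi]
  ring

theorem tendsto_inv_mul_one_sub_exp (s : ℤˣ) :
    Tendsto (fun t : ℝ≥0 => (t : ℝ)⁻¹ * (1 - Real.exp (-(D.q s * t)))) (𝓝[>] 0) (𝓝 (D.q s)) := by
  have hd : HasDerivAt (fun t : ℝ => 1 - Real.exp (-(D.q s * t))) (D.q s) 0 := by
    have h := ((((hasDerivAt_id (0 : ℝ)).const_mul (D.q s : ℝ)).neg).exp).const_sub 1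
    simpa using h
  have ht : Tendsto (fun t : ℝ≥0 => (t : ℝ)) (𝓝[>] 0) (𝓝[≠] 0) := by
    refine tendsto_nhdsWithin_iff.2 ⟨?_, ?_⟩
    · exact (NNReal.continuous_coe.tendsto 0).mono_left nhdsWithin_le_nhds
    · filter_upwards [self_mem_nhdsWithin] with t ht
      exact NNReal.coe_ne_zero.2 (ne_of_gt ht)
  simpa [Function.comp_def] using (hasDerivAt_iff_tendsto_slope_zero.1 hd).comp ht

/-- If `f ∘ (s exp)` is in the domain of the generator of the Lévy process with sign `s`, for both
signs, then `f` is in the domain of the generator of the Lamperti–Kiu process. -/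
theorem hasGenerator_Y [IsProbabilityMeasure P] {f : ℝ → ℝ} (hf : Continuous f) {g : ℤˣ → ℝ → ℝ}
    (hg : ∀ s : ℤˣ, HasGenerator P (translates (D.ξ s 0))
      (fun y => f (((s : ℤ) : ℝ) * Real.exp y)) (g s)) (hb : ∃ C, ∀ x, |f x| ≤ C) :
    HasGenerator P D.Y (fun x : Rstar => f x) (fun x => g (sgn x) (Real.log |(x : ℝ)|) +
      (D.q (sgn x) : ℝ) * ∫ ω, (f (-(x : ℝ) * Real.exp (D.U (sgn x) 0 ω)) - f x) ∂P) := by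
  obtain ⟨C, hC⟩ := hb
  have hC0 : 0 ≤ C := (abs_nonneg _).trans (hC 0)
  have hfm := hf.measurable
  have hUm := fun s => D.measurable_U s 0
  have iU : ∀ (s : ℤˣ) (x : ℝ), Integrable (fun ω => f (-x * Real.exp (D.U s 0 ω))) P :=
    fun s x => Integrable.of_bound (Measurable.aestronglyMeasurable (by have := hUm s; fun_prop)) C
      (ae_of_all _ fun ω => hC _)
  have hJ : ∀ (s : ℤˣ) (x : ℝ), ∫ ω, (f (-x * Real.exp (D.U s 0 ω)) - f x) ∂P =
      ∫ ω, f (-x * Real.exp (D.U s 0 ω)) ∂P - f x := fun s x => by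
    rw [integral_sub (iU s x) (integrable_const _)]; simp
  have hneg : ∀ (x : Rstar) (z : ℝ), -(x : ℝ) * Real.exp z =
      (((-sgn x : ℤˣ) : ℤ) : ℝ) * Real.exp (Real.log |(x : ℝ)| + z) := fun x z => by
    rw [Real.exp_add, ← mul_assoc, Units.val_neg, Int.cast_neg, neg_mul (((sgn x : ℤ)) : ℝ),
      sgn_mul_exp_log]
  refine ⟨?_, ?_, ?_⟩
  · have := isC0_comp_log_abs fun s => (hg s).1
    simpa only [sgn_mul_exp_log] using this
  · have := isC0_comp_log_abs fun s => (hg s).2.1.add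
      ((((hg (-s)).1.integral_add (P := P) (hUm s)).sub (hg s).1).const_mul (D.q s))
    simp only [hJ]
    simpa only [sgn_mul_exp_log, hneg] using this
  -- uniform convergence is checked for each sign separately
  have main : ∀ s : ℤˣ, ∀ ε > 0, ∀ᶠ t : ℝ≥0 in 𝓝[>] 0, ∀ x : Rstar, sgn x = s →
      |(t : ℝ)⁻¹ * (∫ ω, f (D.Y x t ω) ∂P - f x) - (g s (Real.log |(x : ℝ)|) +
        D.q s * (∫ ω, f (-(x : ℝ) * Real.exp (D.U s 0 ω)) ∂P - f x))| < ε := by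
    intro s ε hε
    obtain ⟨M, hM, hgM⟩ := (hg s).2.1.exists_abs_le
    set q : ℝ := NNReal.toReal (D.q s) with hq
    have hq0 : 0 ≤ q := NNReal.coe_nonneg _
    obtain ⟨η, hη, hηε⟩ : ∃ η > 0, (1 + q) * η < ε :=
      ⟨ε / (2 * (1 + q)), by positivity, by field_simp; norm_num⟩
    obtain ⟨δ, hδ, hunif⟩ := Metric.uniformContinuous_iff.1
      ((hg (-s)).1.1.uniformContinuous_of_tendsto_cocompact (hg (-s)).1.2) η hη
    have hδ3 : 0 < δ / 3 := by positivity
    have hunif' : ∀ y z, |z| ≤ 2 * (δ / 3) → |f (((-s : ℤˣ) : ℤ) * Real.exp (y + z)) -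
        f (((-s : ℤˣ) : ℤ) * Real.exp y)| ≤ η := fun y z hz => by
      refine (hunif (a := y + z) (b := y) ?_).le
      rw [Real.dist_eq, add_sub_cancel_left]; linarith
    have t1 := D.tendsto_inv_mul_one_sub_exp s
    have t2 := D.tendsto_one_sub_exp s
    have t3 := D.tendsto_deviation s hδ3
    have t4 : Tendsto (fun t : ℝ≥0 => η + (1 - Real.exp (-(q * t))) * M +
        |(t : ℝ)⁻¹ * (1 - Real.exp (-(q * t))) - q| * (2 * C) +
        (t : ℝ)⁻¹ * (1 - Real.exp (-(q * t))) * (η + 2 * C * D.deviation s (δ / 3) t))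
        (𝓝[>] 0) (𝓝 (η + 0 * M + |q - q| * (2 * C) + q * (η + 2 * C * 0))) :=
      (((t2.mul_const M).const_add η).add ((t1.sub_const q).abs.mul_const _)).add
        (t1.mul ((t3.const_mul (2 * C)).const_add η))
    have hlim : η + 0 * M + |q - q| * (2 * C) + q * (η + 2 * C * 0) < ε := by
      rw [sub_self, abs_zero]; linarith
    filter_upwards [t4.eventually (eventually_lt_nhds hlim),
      Metric.tendstoUniformly_iff.1 (hg s).2.2 η hη, self_mem_nhdsWithin] with t h4 hgen ht x hx
    have ht0 : (0 : ℝ) < t := NNReal.coe_pos.2 ht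
    refine lt_of_le_of_lt ?_ h4
    have hR := D.abs_setIntegral_sub_le hC hη.le hunif' hx ht
    have hY := D.integral_comp_Y hf hC hx t
    have hgx := hgen (Real.log |(x : ℝ)|)
    have hsx := sgn_mul_exp_log x
    rw [hx] at hsx
    simp only [translates, Real.exp_add, ← mul_assoc, hsx] at hgx
    rw [dist_comm, Real.dist_eq] at hgx
    set R := ∫ ω in D.ζ s 0 ⁻¹' Set.Iic (t : ℝ≥0∞),
        (f (D.Y x t ω) - f (-x * Real.exp (D.U s 0 ω))) ∂P
    set Q := ∫ ω, f (x * Real.exp (D.ξ s 0 t ω)) ∂P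
    set J := ∫ ω, f (-x * Real.exp (D.U s 0 ω)) ∂P with hJd
    set e := Real.exp (-(q * t)) with he
    have he0 : 0 < e := Real.exp_pos _
    have he1 : e ≤ 1 := Real.exp_le_one_iff.2 (by have := mul_nonneg hq0 ht0.le; linarith)
    have hJC : |J - f x| ≤ 2 * C := by
      rw [two_mul]
      refine (abs_sub _ _).trans (add_le_add ?_ (hC _))
      have := norm_integral_le_of_norm_le_const (μ := P) (C := C)
        (f := fun ω => f (-x * Real.exp (D.U s 0 ω))) (ae_of_all _ fun ω => hC _)
      simpa only [Real.norm_eq_abs, probReal_univ, mul_one] using this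
    rw [hY]
    have split : (t : ℝ)⁻¹ * (e * Q + (1 - e) * J + R - f x) -
        (g s (Real.log |(x : ℝ)|) + q * (J - f x)) =
        e * ((t : ℝ)⁻¹ * (Q - f x) - g s (Real.log |(x : ℝ)|)) -
        (1 - e) * g s (Real.log |(x : ℝ)|) +
        ((t : ℝ)⁻¹ * (1 - e) - q) * (J - f x) + (t : ℝ)⁻¹ * R := by ring
    rw [split]
    have b1 : |e * ((t : ℝ)⁻¹ * (Q - f x) - g s (Real.log |(x : ℝ)|))| ≤ η := by
      rw [abs_mul, abs_of_pos he0]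
      exact (mul_le_of_le_one_left (abs_nonneg _) he1).trans hgx.le
    have b2 : |(1 - e) * g s (Real.log |(x : ℝ)|)| ≤ (1 - e) * M := by
      rw [abs_mul, abs_of_nonneg (sub_nonneg.2 he1)]
      exact mul_le_mul_of_nonneg_left (hgM _) (sub_nonneg.2 he1)
    have b3 : |((t : ℝ)⁻¹ * (1 - e) - q) * (J - f x)| ≤ |(t : ℝ)⁻¹ * (1 - e) - q| * (2 * C) := by
      rw [abs_mul]
      exact mul_le_mul_of_nonneg_left hJC (abs_nonneg _)
    have b4 : |(t : ℝ)⁻¹ * R| ≤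
        (t : ℝ)⁻¹ * (1 - e) * (η + 2 * C * D.deviation s (δ / 3) t) := by
      rw [abs_mul, abs_of_pos (inv_pos.2 ht0), mul_assoc]
      exact mul_le_mul_of_nonneg_left hR (inv_pos.2 ht0).le
    exact (abs_add_le _ _).trans (add_le_add ((abs_add_le _ _).trans (add_le_add
      ((abs_sub _ _).trans (add_le_add b1 b2)) b3)) b4)
  refine Metric.tendstoUniformly_iff.2 fun ε hε => ?_
  filter_upwards [main 1 ε hε, main (-1) ε hε] with t h1 h2 x
  rw [dist_comm, Real.dist_eq, hJ]
  rcases Int.units_eq_one_or (sgn x) with hx | hx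
  · rw [hx]; exact h1 x hx
  · rw [hx]; exact h2 x hx

end Data

end LampertiKiu

open LampertiKiu in
theorem proposition8 {Ω : Type*} [MeasurableSpace Ω] (P : Measure Ω) [IsProbabilityMeasure P]
    (D : Data P) (f : ℝ → ℝ) (hf_cont : Continuous f) (hf_bdd : ∃ C, ∀ x, |f x| ≤ C)
    (hf_zero : f 0 = 0)
    (hf_pos : (fun y : ℝ => f (Real.exp y)) ∈ generatorDomain P (translates (D.ξ 1 0)))
    (hf_neg : (fun y : ℝ => f (-Real.exp y)) ∈ generatorDomain P (translates (D.ξ (-1) 0))) :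
    (fun x : Rstar => f x) ∈ generatorDomain P D.Y ∧
    (∀ x : Rstar,
      generator P D.Y (fun x : Rstar => f x) x =
        generator P (translates (D.ξ (sgn x) 0)) (fun y : ℝ => f (((sgn x : ℤ) : ℝ) * Real.exp y))
            (Real.log |(x : ℝ)|) +
          (D.q (sgn x) : ℝ) * ∫ ω, (f (-(x : ℝ) * Real.exp (D.U (sgn x) 0 ω)) - f x) ∂P) ∧
    (∀ (l : ℝ → ℝ) (a σ : ℤˣ → ℝ) (π : ℤˣ → Measure ℝ),
      Measurable l → (∃ C, ∀ y, |l y| ≤ C) →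
      (fun y => l y - y) =O[𝓝 0] (fun y => y ^ 2) →
      (∀ s, IsLevyMeasure (π s)) →
      (∀ s, HasCharacteristics P (D.ξ s 0) l (a s) (σ s) (π s)) →
      ContDiffOn ℝ 2 f {0}ᶜ →
      ∀ x : Rstar,
        IntegrableOn (fun u : ℝ => f (x * u) - f x - x * deriv f x * l (Real.log u))
          (Set.Ioi 0) ((π (sgn x)).map Real.exp) ∧
        generator P D.Y (fun x : Rstar => f x) x =
          (a (sgn x) + σ (sgn x) ^ 2 / 2) * x * deriv f x +
            σ (sgn x) ^ 2 / 2 * (x : ℝ) ^ 2 * deriv (deriv f) x +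
            (∫ u in Set.Ioi (0 : ℝ), (f (x * u) - f x - x * deriv f x * l (Real.log u))
              ∂((π (sgn x)).map Real.exp)) +
            (D.q (sgn x) : ℝ) * ∫ ω, (f (-(x : ℝ) * Real.exp (D.U (sgn x) 0 ω)) - f x) ∂P) := by
  have hA : ∀ s : ℤˣ, ∃ g, HasGenerator P (translates (D.ξ s 0))
      (fun y => f (((s : ℤ) : ℝ) * Real.exp y)) g := fun s => by
    rcases Int.units_eq_one_or s with rfl | rfl
    · simpa [generatorDomain] using hf_pos
    · simpa [generatorDomain] using hf_neg
  choose g hg using hA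
  have hK := D.hasGenerator_Y hf_cont hg hf_bdd
  refine ⟨⟨_, hK⟩, fun x => ?_, fun l a σ π hl hlb hlo hπ hchar hf2 x => ?_⟩
  · rw [hK.generator_eq, (hg (sgn x)).generator_eq]
  · have hs : (((sgn x : ℤˣ) : ℤ) : ℝ) ≠ 0 := by exact_mod_cast (sgn x).ne_zero
    obtain ⟨C, hC⟩ := hf_bdd
    obtain ⟨h1, h2⟩ := (hg (sgn x)).eq_of_hasCharacteristics (D.levy _ _).measurable hl hlb hlo
      (hπ _) (hchar _) (contDiff_comp_mul_exp hf2 hs) ⟨C, fun y => hC _⟩ (Real.log |(x : ℝ)|)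
    obtain ⟨h3, h4⟩ := integroDifferential_comp_mul_exp hf2 hs l (a (sgn x)) (σ (sgn x))
      (π (sgn x)) (sgn_mul_exp_log x) rfl
    refine ⟨h3 h1, ?_⟩
    rw [hK.generator_eq]
    simp only
    rw [h2, h4]
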